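/- Let $n,d\ge 1$ and $B>0$, and let $X=(X_1,\dots,X_n)$ be independent samples from $N(0,\Sigma)$ on $\mathbb{R}^d$, where the unknown $\Sigma$ lies in the set $\Xi$ of symmetric positive definite $d\times d$ matrices with spectral norm $\|\Sigma\|_2\le B$. A deterministic estimator is a measurable map $\hat\Sigma:(\mathbb{R}^d)^n\to\Xi$; a randomized estimator is a random deterministic estimator drawn independently of the data (jointly measurably in the draw and the data). The loss is the entropy loss $$M(\Sigma_1,\Sigma_2)=\operatorname{tr}(\Sigma_1^{-1}\Sigma_2)-\log|\Sigma_1^{-1}\Sigma_2|-d\ \ge 0,$$ the risk is $R(\hat\Sigma,\Sigma)=\mathbb{E}[M(\hat\Sigma(X),\Sigma)]\in[0,\infty]$ (expectation over the data and the draw), and the minimax risk $R^*=\inf_{\hat\Sigma}\sup_{\Sigma\in\Xi}R(\hat\Sigma,\Sigma)$ is the infimum over all randomized estimators. Let $S_n=\frac1n\sum_{i=1}^nX_iX_i^T=U\Delta U^T$ be the eigendecomposition of the empirical covariance matrix, with $\Delta_i$ the $i$-th diagonal entry of $\Delta$. For Borel functions $f:\mathbb{R}\times\mathbb{R}^d\to\mathbb{R}$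 and $g:\mathbb{R}^2\to\mathbb{R}^d$ put $$\hat\Sigma_{f,g}(X)=U\,\mathrm{Diag}\Big(f\big(\Delta_i,\textstyle\sum_{j\ne i}g(\Delta_i,\Delta_j)\big)\Big)_{i=1}^d\,U^T ,$$ which does not depend on the choice of the eigendecomposition. Let $\mathcal{D}_{f,g}$ be the set of deterministic estimators of this form and $\mathcal{M}_{f,g}$ the set of randomized estimators supported on $\mathcal{D}_{f,g}$; let $\mathcal{M}_{\mathcal{D},G}$ be the set of randomized estimators supported on the deterministic estimators that satisfy $\hat\Sigma(VX_1,\dots,VX_n)=V\hat\Sigma(X_1,\dots,X_n)V^T$ for every orthogonal matrix $V$ and all data. Then: (i) There is a deterministic estimator $\hat\Sigma^*$ that is minimax, i.e. $\sup_{\Sigma\in\Xi}R(\hat\Sigma^*,\Sigma)=R^*$, and that can be approximated arbitrarily well by estimators in $\mathcal{D}_{f,g}$: for every $\varepsilon>0$ there is $\hat\Sigma_{f,g}\in\mathcal{D}_{f,g}$ with $\|\hat\Sigma_{f,g}(X)-\hat\Sigma^*(X)\|_2\le\varepsilon$ for all data $X$ and, for all $\Sigma\in\Xi$, $R(\hat\Sigma_{f,g},\Sigma)\le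 R(\hat\Sigma^*,\Sigma)+\varepsilon$ and $R(\hat\Sigma^*,\Sigma)\le R(\hat\Sigma_{f,g},\Sigma)+\varepsilon$. (ii) With $\Xi_G=\{\lambda\in\mathbb{R}^d: B\ge\lambda_1\ge\dots\ge\lambda_d>0\}$, $$\inf_{\hat\Sigma\in\mathcal{M}_{\mathcal{D},G}}\ \sup_{\lambda\in\Xi_G}R(\hat\Sigma,\mathrm{Diag}(\lambda))=\inf_{\hat\Sigma\in\mathcal{M}_{f,g}}\ \sup_{\lambda\in\Xi_G}R(\hat\Sigma,\mathrm{Diag}(\lambda))=R^*.$$ -/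

import Mathlib

open MeasureTheory ProbabilityTheory
open scoped ENNReal Matrix

noncomputable section

namespace CovarianceGame

/-- The data: `n` observations in `ℝ^d`. -/
abbrev Sample (n d : ℕ) : Type := Fin n → EuclideanSpace ℝ (Fin d)

/-- The spectral (ℓ² operator) norm of a real square matrix. -/
def opNorm {d : ℕ} (A : Matrix (Fin d) (Fin d) ℝ) : ℝ :=
  ‖Matrix.toEuclideanCLM (n := Fin d) (𝕜 := ℝ) A‖

/-- The parameter space: symmetric positive definite matrices of spectral norm at most `B`. -/
def paramSpace (d : ℕ) (B : ℝ) : Set (Matrix (Fin d) (Fin d) ℝ) :=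
  {S | S.PosDef ∧ opNorm S ≤ B}

/-- The reduced parameter space: vectors `λ` with `B ≥ λ₁ ≥ ⋯ ≥ λ_d > 0`. -/
def spectrumSpace (d : ℕ) (B : ℝ) : Set (Fin d → ℝ) :=
  {l | Antitone l ∧ ∀ i, 0 < l i ∧ l i ≤ B}

/-- The law of `n` independent samples from `N(0, S)`. -/
def sampleLaw (n : ℕ) {d : ℕ} (S : Matrix (Fin d) (Fin d) ℝ) : Measure (Sample n d) :=
  Measure.pi fun _ => multivariateGaussian 0 S

/-- The entropy loss `M(A, S) = tr(A⁻¹ S) - log |A⁻¹ S| - d` of the estimate `A` when the true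
covariance matrix is `S`. -/
def entropyLoss {d : ℕ} (A S : Matrix (Fin d) (Fin d) ℝ) : ℝ :=
  (A⁻¹ * S).trace - Real.log (A⁻¹ * S).det - d

/-- The empirical covariance matrix `S_n = (1/n) ∑ Xᵢ Xᵢᵀ`. -/
def empiricalCov {n d : ℕ} (X : Sample n d) : Matrix (Fin d) (Fin d) ℝ :=
  (n : ℝ)⁻¹ • ∑ k, Matrix.vecMulVec (X k).ofLp (X k).ofLp

/-- The action `X ↦ (g X₁, …, g X_n)` of a matrix on the data. -/
def actSample {n d : ℕ} (g : Matrix (Fin d) (Fin d) ℝ) (X : Sample n d) : Sample n d :=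
  fun k => WithLp.toLp 2 (g *ᵥ (X k).ofLp)

/-- A deterministic estimator: a measurable map from the data to the parameter space. -/
structure Estimator (n d : ℕ) (B : ℝ) where
  /-- the estimate computed from the data -/
  est : Sample n d → Matrix (Fin d) (Fin d) ℝ
  measurable_est : ∀ i j, Measurable fun X => est X i j
  est_mem : ∀ X, est X ∈ paramSpace d B

/-- The risk `R(Σ̂, S) = 𝔼[M(Σ̂(X), S)]`. The entropy loss of positive definite matrices is
nonnegative, so that the expectation always exists in `[0, ∞]`. -/
def Estimator.risk {n d : ℕ} {B : ℝ} (δ : Estimator n d B) (S : Matrix (Fin d) (Fin d) ℝ) :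
    ℝ≥0∞ :=
  ∫⁻ X, ENNReal.ofReal (entropyLoss (δ.est X) S) ∂(sampleLaw n S)

/-- A randomized estimator supported on a class `C` of deterministic estimators: a deterministic
estimator in `C` is drawn by means of a random seed `ω`, independent of the data, jointly
measurably in the seed and the data. (In general there is no σ-algebra on the set of all measurable maps for
which evaluation is jointly measurable, so that a probability measure on this set has to be
presented through such a random element.) -/
structure RandomizedEstimator {n d : ℕ} {B : ℝ} (C : Set (Estimator n d B)) where
  /-- the space of seeds -/
  Seed : Type
  [seedMeasurableSpace : MeasurableSpace Seed]
  /-- the law of the seed -/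
  law : Measure Seed
  [isProbabilityMeasure_law : IsProbabilityMeasure law]
  /-- the deterministic estimator that is used when the seed is drawn -/
  draw : Seed → Estimator n d B
  draw_mem : ∀ ω, draw ω ∈ C
  measurable_draw : ∀ i j, Measurable fun p : Seed × Sample n d => (draw p.1).est p.2 i j

attribute [instance] RandomizedEstimator.seedMeasurableSpace
  RandomizedEstimator.isProbabilityMeasure_law

/-- The risk of a randomized estimator: the expectation is over the data and the seed. -/
def RandomizedEstimator.risk {n d : ℕ} {B : ℝ} {C : Set (Estimator n d B)}
    (T : RandomizedEstimator C) (S : Matrix (Fin d) (Fin d) ℝ) : ℝ≥0∞ :=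
  ∫⁻ ω, (T.draw ω).risk S ∂T.law

/-- The minimax risk `R*`: the infimum over all randomized estimators of the worst-case risk. -/
def minimaxRisk (n d : ℕ) (B : ℝ) : ℝ≥0∞ :=
  ⨅ T : RandomizedEstimator (Set.univ : Set (Estimator n d B)), ⨆ S ∈ paramSpace d B, T.risk S

/-- The value of the reduced game, in which the statistician randomizes over a class `C` of
deterministic estimators and nature chooses `Diag(λ)` with `B ≥ λ₁ ≥ ⋯ ≥ λ_d > 0`. -/
def reducedValue {n d : ℕ} {B : ℝ} (C : Set (Estimator n d B)) : ℝ≥0∞ :=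
  ⨅ T : RandomizedEstimator C, ⨆ l ∈ spectrumSpace d B, T.risk (Matrix.diagonal l)

/-- A deterministic estimator is minimax if its worst-case risk is the minimax risk `R*`. -/
def Estimator.IsMinimax {n d : ℕ} {B : ℝ} (δ : Estimator n d B) : Prop :=
  (⨆ S ∈ paramSpace d B, δ.risk S) = minimaxRisk n d B

/-- The deterministic estimators that are invariant under the orthogonal group:
`Σ̂(g X) = g Σ̂(X) gᵀ`. -/
def invariantEstimators (n d : ℕ) (B : ℝ) : Set (Estimator n d B) :=
  {δ | ∀ g ∈ Matrix.orthogonalGroup (Fin d) ℝ, ∀ X, δ.est (actSample g X) = g * δ.est X * gᵀ}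

/-- The `i`-th diagonal entry `f(Δᵢ, ∑_{j ≠ i} g(Δᵢ, Δⱼ))`. -/
def spectralEntry {d : ℕ} (f : ℝ → (Fin d → ℝ) → ℝ) (g : ℝ → ℝ → (Fin d → ℝ)) (D : Fin d → ℝ)
    (i : Fin d) : ℝ :=
  f (D i) (∑ j ∈ Finset.univ.erase i, g (D i) (D j))

/-- The deterministic estimator `δ` is `Σ̂_{f,g}`: whenever `U Diag(Δ) Uᵀ` is an
eigendecomposition of `S_n`, the estimate is `U Diag(f(Δᵢ, ∑_{j ≠ i} g(Δᵢ, Δⱼ))) Uᵀ`. Every `S_n`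
has an eigendecomposition, and the value does not depend on its choice. -/
def Estimator.IsSpectral {n d : ℕ} {B : ℝ} (δ : Estimator n d B)
    (f : ℝ → (Fin d → ℝ) → ℝ) (g : ℝ → ℝ → (Fin d → ℝ)) : Prop :=
  ∀ X : Sample n d, ∀ U ∈ Matrix.orthogonalGroup (Fin d) ℝ, ∀ D : Fin d → ℝ,
    empiricalCov X = U * Matrix.diagonal D * Uᵀ →
      δ.est X = U * Matrix.diagonal (spectralEntry f g D) * Uᵀ

/-- The deterministic estimators of the form `Σ̂_{f,g}` with Borel functions
`f : ℝ × ℝ^d → ℝ` and `g : ℝ × ℝ → ℝ^d`. -/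
def spectralEstimators (n d : ℕ) (B : ℝ) : Set (Estimator n d B) :=
  {δ | ∃ (f : ℝ → (Fin d → ℝ) → ℝ) (g : ℝ → ℝ → (Fin d → ℝ)),
    Measurable (Function.uncurry f) ∧ Measurable (Function.uncurry g) ∧ δ.IsSpectral f g}

end CovarianceGame

end

/-!
The entropy loss is convex in the precision matrix `A⁻¹` of the estimate `A`, so that averaging
precision matrices does not increase the expected loss. Averaging over the seed makes a randomized
estimator deterministic, and averaging over the Haar measure of `O(d) × O(n)`, which preserves the
model, makes it equivariant: an estimator that commutes with `O(d)` and does not change when the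
sample is mixed by `O(n)` depends on the empirical covariance matrix alone.

The infimum over equivariant estimators is attained. Among estimators whose worst-case risk is close
to the minimax risk choose a sequence that nearly minimizes the mean trace. The harmonic mean of two
estimates has small trace gap only if the estimates are close, hence the sequence is Cauchy in `L²`
and a subsequence converges almost everywhere; the loss is lower semicontinuous, so Fatou's lemma
bounds the risk of the limit, which is then averaged over the group once more.

An equivariant estimator shares its eigenvectors with the empirical covariance matrix, and its
eigenvalues are a function of the eigenvalue `Δᵢ` and of the multiset of all eigenvalues. By
Newton's identities and the Lusin–Souslin theorem the latter is a Borel function of the power sums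
`∑ⱼ Δⱼᵏ`, so that the estimator is of the form `Σ̂_{f,g}`.
-/

noncomputable section

namespace CovarianceGame

open scoped Matrix.Norms.L2Operator

/-! ### Positive definite matrices -/

section LinearAlgebra

lemma isClosed_setOf_posSemidef {m : Type*} [Finite m] :
    IsClosed {M : Matrix m m ℝ | M.PosSemidef} := by
  cases nonempty_fintype m
  simp only [Matrix.posSemidef_iff_dotProduct_mulVec, Set.ofPred_and, Set.ofPred_forall]
  refine (isClosed_eq continuous_id.matrix_conjTranspose continuous_id).inter
    (isClosed_iInter fun x => isClosed_le continuous_const ?_)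
  fun_prop

variable {m : Type*} [Fintype m] {A C P S W g : Matrix m m ℝ}

lemma posSemidef_mul_mul_transpose (hA : A.PosSemidef) (C : Matrix m m ℝ) :
    (C * A * Cᵀ).PosSemidef := by
  simpa only [Matrix.conjTranspose_eq_transpose_of_trivial] using hA.mul_mul_conjTranspose_same C

open scoped MatrixOrder in
lemma exists_eq_transpose_mul_self (hA : A.PosSemidef) : ∃ C : Matrix m m ℝ, A = Cᵀ * C := by
  classical
  obtain ⟨C, hC⟩ := CStarAlgebra.nonneg_iff_eq_star_mul_self.mp hA.nonneg
  exact ⟨C, by rw [hC, Matrix.star_eq_conjTranspose, Matrix.conjTranspose_eq_transpose_of_trivial]⟩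

variable [DecidableEq m]

lemma posDef_mul_mul_transpose (hA : A.PosDef) (hC : IsUnit C) : (C * A * Cᵀ).PosDef := by
  rw [← Matrix.conjTranspose_eq_transpose_of_trivial, ← Matrix.star_eq_conjTranspose]
  exact (Matrix.IsUnit.posDef_star_right_conjugate_iff hC).2 hA

lemma norm_le_trace (hA : A.PosSemidef) : ‖A‖ ≤ A.trace := by
  have trace_eq : A.trace = ∑ i, hA.isHermitian.eigenvalues i := by
    simpa using hA.isHermitian.trace_eq_sum_eigenvalues
  conv_lhs => rw [hA.isHermitian.spectral_theorem, Unitary.conjStarAlgAut_apply]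
  rw [← Unitary.coe_star, CStarRing.norm_mul_coe_unitary, CStarRing.norm_coe_unitary_mul,
    Matrix.l2_opNorm_diagonal, trace_eq]
  refine (pi_norm_le_iff_of_nonneg (Finset.sum_nonneg fun i _ => hA.eigenvalues_nonneg i)).2
    fun i => ?_
  rw [Function.comp_apply, RCLike.norm_ofReal, abs_of_nonneg (hA.eigenvalues_nonneg i)]
  exact Finset.single_le_sum (fun j _ => hA.eigenvalues_nonneg j) (Finset.mem_univ i)

lemma log_det_le_trace_sub_card (hW : W.PosDef) :
    Real.log W.det ≤ W.trace - Fintype.card m := by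
  have trace_eq := hW.isHermitian.trace_eq_sum_eigenvalues
  have det_eq := hW.isHermitian.det_eq_prod_eigenvalues
  simp only [RCLike.ofReal_real_eq_id, id_eq] at trace_eq det_eq
  calc Real.log W.det = ∑ i, Real.log (hW.isHermitian.eigenvalues i) := by
        rw [det_eq, Real.log_prod fun i _ => (hW.eigenvalues_pos i).ne']
    _ ≤ ∑ i, (hW.isHermitian.eigenvalues i - 1) :=
        Finset.sum_le_sum fun i _ => Real.log_le_sub_one_of_pos (hW.eigenvalues_pos i)
    _ = W.trace - Fintype.card m := by simp [trace_eq]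

lemma log_det_mul_le_trace_mul_sub_card (hP : P.PosDef) (hS : S.PosDef) :
    Real.log (P * S).det ≤ (P * S).trace - Fintype.card m := by
  obtain ⟨K, rfl⟩ := exists_eq_transpose_mul_self hP.posSemidef
  have hK : IsUnit K := by
    rw [Matrix.isUnit_iff_isUnit_det]
    have hdet := (Matrix.isUnit_iff_isUnit_det _).1 hP.isUnit
    rw [Matrix.det_mul] at hdet
    exact isUnit_of_mul_isUnit_right hdet
  -- `Kᵀ K S` is similar to the positive definite matrix `K S Kᵀ`
  have h := log_det_le_trace_sub_card (posDef_mul_mul_transpose hS hK)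
  rwa [Matrix.trace_mul_comm, Matrix.det_mul_comm, ← Matrix.mul_assoc] at h

/-! ### Orthogonal matrices -/

lemma mul_transpose_of_mem_orthogonalGroup (hg : g ∈ Matrix.orthogonalGroup m ℝ) : g * gᵀ = 1 :=
  (Matrix.mem_orthogonalGroup_iff m ℝ).1 hg

lemma transpose_mul_of_mem_orthogonalGroup (hg : g ∈ Matrix.orthogonalGroup m ℝ) : gᵀ * g = 1 :=
  (Matrix.mem_orthogonalGroup_iff' m ℝ).1 hg

lemma isUnit_of_mem_orthogonalGroup (hg : g ∈ Matrix.orthogonalGroup m ℝ) : IsUnit g :=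
  IsUnit.of_mul_eq_one gᵀ (mul_transpose_of_mem_orthogonalGroup hg)

lemma transpose_mem_orthogonalGroup (hg : g ∈ Matrix.orthogonalGroup m ℝ) :
    gᵀ ∈ Matrix.orthogonalGroup m ℝ := by
  rw [Matrix.mem_orthogonalGroup_iff]
  simpa using transpose_mul_of_mem_orthogonalGroup hg

lemma transpose_mul_mul_transpose_mul (hg : g ∈ Matrix.orthogonalGroup m ℝ) (A : Matrix m m ℝ) :
    gᵀ * (g * A * gᵀ) * g = A := by
  simp only [← Matrix.mul_assoc, transpose_mul_of_mem_orthogonalGroup hg, Matrix.one_mul]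
  rw [Matrix.mul_assoc, transpose_mul_of_mem_orthogonalGroup hg, Matrix.mul_one]

lemma inv_mul_mul_transpose (hg : g ∈ Matrix.orthogonalGroup m ℝ) (A : Matrix m m ℝ) :
    (g * A * gᵀ)⁻¹ = g * A⁻¹ * gᵀ := by
  rw [Matrix.mul_inv_rev, Matrix.mul_inv_rev,
    Matrix.inv_eq_right_inv (mul_transpose_of_mem_orthogonalGroup hg),
    Matrix.inv_eq_right_inv (transpose_mul_of_mem_orthogonalGroup hg), Matrix.mul_assoc]

end LinearAlgebra

section EntropyLoss

variable {d : ℕ} {A P Q S g : Matrix (Fin d) (Fin d) ℝ} {B : ℝ}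

/-! ### The entropy loss -/

lemma entropyLoss_nonneg (hA : A.PosDef) (hS : S.PosDef) : 0 ≤ entropyLoss A S := by
  have h := log_det_mul_le_trace_mul_sub_card hA.inv hS
  rw [Fintype.card_fin] at h
  rw [entropyLoss]
  linarith

lemma entropyLoss_eq (hA : A.PosDef) (hS : S.PosDef) :
    entropyLoss A S = (A⁻¹ * S).trace + Real.log A.det - Real.log S.det - d := by
  rw [entropyLoss, Matrix.det_mul, Real.log_mul hA.inv.det_pos.ne' hS.det_pos.ne',
    Matrix.det_nonsing_inv, Ring.inverse_eq_inv', Real.log_inv]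
  ring

/-- The tangent inequality of the convex function `P ↦ entropyLoss P⁻¹ S` of the precision
matrix at the point `Q`. -/
lemma entropyLoss_inv_add_trace_le (hP : P.PosDef) (hQ : Q.PosDef) (hS : S.PosDef) :
    entropyLoss Q⁻¹ S + ((P - Q) * (S - Q⁻¹)).trace ≤ entropyLoss P⁻¹ S := by
  have bregman := entropyLoss_nonneg hQ hP
  have hP' : P⁻¹⁻¹ = P := Matrix.nonsing_inv_nonsing_inv _ hP.det_pos.ne'.isUnit
  have hQ' : Q⁻¹⁻¹ = Q := Matrix.nonsing_inv_nonsing_inv _ hQ.det_pos.ne'.isUnit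
  have hQQ : Q * Q⁻¹ = 1 := Matrix.mul_nonsing_inv _ hQ.det_pos.ne'.isUnit
  rw [entropyLoss_eq hQ hP, Matrix.trace_mul_comm] at bregman
  rw [entropyLoss_eq hP.inv hS, entropyLoss_eq hQ.inv hS, hP', hQ']
  simp only [Matrix.sub_mul, Matrix.mul_sub, Matrix.trace_sub, hQQ, Matrix.trace_one,
    Fintype.card_fin, Matrix.det_nonsing_inv, Ring.inverse_eq_inv', Real.log_inv]
  linarith

lemma trace_inv_mul_le_entropyLoss (hA : A.PosDef) (hS : S.PosDef) :
    (A⁻¹ * S).trace ≤ 2 * (entropyLoss A S + d * Real.log 2) := by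
  have h := log_det_mul_le_trace_mul_sub_card
    (hA.inv.smul (show (0 : ℝ) < 2⁻¹ by norm_num)) hS
  rw [Matrix.smul_mul, Matrix.det_smul, Fintype.card_fin, Matrix.trace_smul, Matrix.det_mul,
    Real.log_mul (by positivity) (mul_pos hA.inv.det_pos hS.det_pos).ne', Real.log_pow,
    Real.log_inv, smul_eq_mul, ← Matrix.det_mul] at h
  rw [entropyLoss]
  linarith

lemma log_det_sub_log_det_le_entropyLoss (hA : A.PosDef) (hS : S.PosDef) :
    Real.log S.det - Real.log A.det + d - 2 * (d * Real.log 2) ≤ entropyLoss A S := by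
  linarith [trace_inv_mul_le_entropyLoss hA hS, entropyLoss_eq hA hS]

lemma entropyLoss_mul_mul_transpose (hg : g ∈ Matrix.orthogonalGroup (Fin d) ℝ)
    (A S : Matrix (Fin d) (Fin d) ℝ) :
    entropyLoss (g * A * gᵀ) (g * S * gᵀ) = entropyLoss A S := by
  have hconj : (g * A * gᵀ)⁻¹ * (g * S * gᵀ) = g * (A⁻¹ * S * gᵀ) := by
    rw [inv_mul_mul_transpose hg]
    simp only [Matrix.mul_assoc]
    rw [← Matrix.mul_assoc gᵀ g, transpose_mul_of_mem_orthogonalGroup hg, Matrix.one_mul]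
  rw [entropyLoss, entropyLoss, hconj, Matrix.trace_mul_comm, Matrix.det_mul_comm,
    Matrix.mul_assoc, transpose_mul_of_mem_orthogonalGroup hg, Matrix.mul_one]

/-! ### The parameter space -/

lemma opNorm_le_iff (hS : S.PosSemidef) (hB : 0 ≤ B) :
    opNorm S ≤ B ↔ (B • 1 - S).PosSemidef := by
  have herm : (B • 1 - S).IsHermitian :=
    (Matrix.isHermitian_one.smul (IsSelfAdjoint.all B)).sub hS.isHermitian
  obtain ⟨C, rfl⟩ := exists_eq_transpose_mul_self hS
  have opNorm_eq : opNorm (Cᵀ * C) = ‖Matrix.toEuclideanCLM (n := Fin d) (𝕜 := ℝ) C‖ ^ 2 := by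
    rw [opNorm, map_mul, sq, ← CStarRing.norm_star_mul_self, ← map_star,
      Matrix.star_eq_conjTranspose, Matrix.conjTranspose_eq_transpose_of_trivial]
  rw [opNorm_eq, ← Real.le_sqrt (norm_nonneg _) hB,
    ContinuousLinearMap.opNorm_le_iff (Real.sqrt_nonneg B), Matrix.posSemidef_iff_dotProduct_mulVec,
    and_iff_right herm, (WithLp.equiv 2 (Fin d → ℝ)).forall_congr_left]
  refine forall_congr' fun x => ?_
  have norm_sq (y : Fin d → ℝ) : ‖WithLp.toLp 2 y‖ ^ 2 = y ⬝ᵥ y := by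
    rw [EuclideanSpace.real_norm_sq_eq]
    simp only [dotProduct, sq]
  have gram : x ⬝ᵥ (Cᵀ * C) *ᵥ x = C *ᵥ x ⬝ᵥ C *ᵥ x := by
    rw [← Matrix.mulVec_mulVec, Matrix.dotProduct_mulVec, Matrix.vecMul_transpose]
  rw [WithLp.equiv_symm_apply, Matrix.toEuclideanCLM_toLp,
    ← sq_le_sq₀ (norm_nonneg _) (by positivity), mul_pow, Real.sq_sqrt hB, norm_sq, norm_sq,
    star_trivial, Matrix.sub_mulVec, dotProduct_sub, gram, sub_nonneg, Matrix.smul_mulVec,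
    Matrix.one_mulVec, dotProduct_smul, smul_eq_mul]

lemma mem_paramSpace_iff (hB : 0 ≤ B) :
    S ∈ paramSpace d B ↔ S.PosDef ∧ (B • 1 - S).PosSemidef :=
  and_congr_right fun h => opNorm_le_iff h.posSemidef hB

/-- Inversion reverses the Loewner order: both sides say that the block matrix with diagonal
blocks `A` and `D` and off-diagonal blocks `1` is positive semidefinite. -/
lemma posSemidef_sub_inv_comm {m : Type*} [Fintype m] [DecidableEq m] {A D : Matrix m m ℝ}
    (hA : A.PosDef) (hD : D.PosDef) : (D - A⁻¹).PosSemidef ↔ (A - D⁻¹).PosSemidef := by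
  have := hA.isUnit.invertible
  have := hD.isUnit.invertible
  have h₁ := Matrix.PosDef.fromBlocks₁₁ 1 D hA
  have h₂ := Matrix.PosDef.fromBlocks₂₂ A 1 hD
  simp only [Matrix.conjTranspose_one, Matrix.one_mul, Matrix.mul_one] at h₁ h₂
  exact h₁.symm.trans h₂

lemma mem_paramSpace_iff_inv (hB : 0 < B) :
    S ∈ paramSpace d B ↔ S.PosDef ∧ (S⁻¹ - B⁻¹ • 1).PosSemidef := by
  rw [mem_paramSpace_iff hB.le]
  refine and_congr_right fun hS => ?_
  have h := posSemidef_sub_inv_comm hS.inv (Matrix.PosDef.one.smul hB)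
  have hBinv : (B • (1 : Matrix (Fin d) (Fin d) ℝ))⁻¹ = B⁻¹ • 1 :=
    Matrix.inv_eq_left_inv (by simp [smul_smul, hB.ne'])
  rwa [Matrix.nonsing_inv_nonsing_inv _ hS.det_pos.ne'.isUnit, hBinv] at h

lemma smul_one_mem_paramSpace (hB : 0 < B) :
    B • (1 : Matrix (Fin d) (Fin d) ℝ) ∈ paramSpace d B :=
  (mem_paramSpace_iff hB.le).2 ⟨Matrix.PosDef.one.smul hB, by simpa using Matrix.PosSemidef.zero⟩

lemma opNorm_eq_norm (A : Matrix (Fin d) (Fin d) ℝ) : opNorm A = ‖A‖ := rfl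

lemma mul_mul_transpose_mem_paramSpace (hS : S ∈ paramSpace d B)
    (hg : g ∈ Matrix.orthogonalGroup (Fin d) ℝ) : g * S * gᵀ ∈ paramSpace d B := by
  refine ⟨posDef_mul_mul_transpose hS.1 (isUnit_of_mem_orthogonalGroup hg), ?_⟩
  rw [opNorm_eq_norm, CStarRing.norm_mul_mem_unitary _ (transpose_mem_orthogonalGroup hg),
    CStarRing.norm_mem_unitary_mul _ hg]
  exact hS.2

end EntropyLoss

/-! ### Samples and their symmetries -/

/-- Two linear maps that induce the same seminorm differ by an isometry of the target. -/
lemma exists_linearIsometry_apply_eq {V W : Type*} [AddCommGroup V] [Module ℝ V]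
    [NormedAddCommGroup W] [InnerProductSpace ℝ W] [FiniteDimensional ℝ W] {a b : V →ₗ[ℝ] W}
    (h : ∀ u, ‖a u‖ = ‖b u‖) : ∃ T : W →ₗᵢ[ℝ] W, ∀ u, T (a u) = b u := by
  obtain ⟨s, hs⟩ := a.rangeRestrict.exists_rightInverse_of_surjective a.range_rangeRestrict
  have a_s (y : LinearMap.range a) : a (s y) = y :=
    congrArg Subtype.val (LinearMap.congr_fun hs y)
  let L : LinearMap.range a →ₗᵢ[ℝ] W :=
    { toLinearMap := b ∘ₗ s
      norm_map' := fun y => by rw [LinearMap.comp_apply, ← h, a_s, Submodule.coe_norm] }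
  refine ⟨L.extend, fun u => ?_⟩
  have hker : b (s ⟨a u, u, rfl⟩ - u) = 0 := by
    rw [← norm_eq_zero, ← h, map_sub, a_s, sub_self, norm_zero]
  rw [map_sub, sub_eq_zero] at hker
  exact (L.extend_apply ⟨a u, u, rfl⟩).trans hker

lemma exists_mem_orthogonalGroup_mul_eq {k m : Type*} [Fintype k] [DecidableEq k] [Finite m]
    {M N : Matrix k m ℝ} (h : Mᵀ * M = Nᵀ * N) :
    ∃ o ∈ Matrix.orthogonalGroup k ℝ, o * M = N := by
  classical
  cases nonempty_fintype m
  have norm_sq (M : Matrix k m ℝ) (u : EuclideanSpace ℝ m) :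
      ‖Matrix.toEuclideanLin M u‖ ^ 2 = u.ofLp ⬝ᵥ (Mᵀ * M) *ᵥ u.ofLp := by
    rw [EuclideanSpace.real_norm_sq_eq, ← Matrix.mulVec_mulVec, Matrix.dotProduct_mulVec,
      Matrix.vecMul_transpose]
    simp only [Matrix.ofLp_toLpLin, Matrix.toLin'_apply, dotProduct, sq]
  obtain ⟨T, hT⟩ := exists_linearIsometry_apply_eq (a := Matrix.toEuclideanLin M)
    (b := Matrix.toEuclideanLin N) fun u => by
      rw [← pow_left_inj₀ (norm_nonneg _) (norm_nonneg _) two_ne_zero, norm_sq, norm_sq, h]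
  have star_mul_self : star T.toContinuousLinearMap * T.toContinuousLinearMap = 1 :=
    (ContinuousLinearMap.norm_map_iff_adjoint_comp_self _).1 T.norm_map
  obtain ⟨o, ho⟩ : ∃ o, Matrix.toEuclideanCLM (n := k) (𝕜 := ℝ) o = T.toContinuousLinearMap :=
    EquivLike.surjective _ _
  refine ⟨o, ?_, ?_⟩
  · rw [Matrix.mem_orthogonalGroup_iff', ← Matrix.conjTranspose_eq_transpose_of_trivial,
      ← Matrix.star_eq_conjTranspose]
    apply EquivLike.injective (Matrix.toEuclideanCLM (n := k) (𝕜 := ℝ))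
    rw [map_mul, map_star, ho, star_mul_self, map_one]
  · refine Matrix.toEuclideanLin.injective (LinearMap.ext fun u => ?_)
    have T_apply : T (Matrix.toEuclideanLin M u) =
        Matrix.toEuclideanCLM (n := k) (𝕜 := ℝ) o (Matrix.toEuclideanLin M u) := by
      rw [ho, LinearIsometry.coe_toContinuousLinearMap]
    rw [← hT, T_apply]
    apply WithLp.ofLp_injective 2
    rw [Matrix.ofLp_toEuclideanCLM, Matrix.ofLp_toLpLin, Matrix.ofLp_toLpLin, Matrix.toLin'_apply,
      Matrix.toLin'_apply, Matrix.mulVec_mulVec]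

section Samples

variable {n d : ℕ} {S : Matrix (Fin d) (Fin d) ℝ}

/-- The data matrix, whose rows are the observations. -/
def dataMatrix (X : Sample n d) : Matrix (Fin n) (Fin d) ℝ :=
  Matrix.of fun k => (X k).ofLp

/-- The action of an `n × n` matrix on the data by linear combinations of the observations. Under
an orthogonal matrix the law of a centred Gaussian sample and its empirical covariance matrix are
invariant. -/
def mixSample (o : Matrix (Fin n) (Fin n) ℝ) (X : Sample n d) : Sample n d :=
  fun k => ∑ l, o k l • X l

lemma dataMatrix_injective : Function.Injective (dataMatrix : Sample n d → _) :=
  fun _ _ h => funext fun k => WithLp.ofLp_injective 2 (congrFun h k)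

lemma dataMatrix_actSample (g : Matrix (Fin d) (Fin d) ℝ) (X : Sample n d) :
    dataMatrix (actSample g X) = dataMatrix X * gᵀ := by
  ext k i
  simp [dataMatrix, actSample, Matrix.mul_apply, Matrix.mulVec, dotProduct, mul_comm]

lemma dataMatrix_mixSample (o : Matrix (Fin n) (Fin n) ℝ) (X : Sample n d) :
    dataMatrix (mixSample o X) = o * dataMatrix X := by
  ext k i
  simp [dataMatrix, mixSample, Matrix.mul_apply]

lemma empiricalCov_eq (X : Sample n d) :
    empiricalCov X = (n : ℝ)⁻¹ • ((dataMatrix X)ᵀ * dataMatrix X) := by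
  ext i j
  simp [empiricalCov, dataMatrix, Matrix.mul_apply, Matrix.sum_apply, Matrix.vecMulVec_apply]

lemma posSemidef_empiricalCov (X : Sample n d) : (empiricalCov X).PosSemidef := by
  rw [empiricalCov_eq, ← Matrix.conjTranspose_eq_transpose_of_trivial]
  exact (Matrix.posSemidef_conjTranspose_mul_self _).smul (by positivity)

lemma empiricalCov_actSample (g : Matrix (Fin d) (Fin d) ℝ) (X : Sample n d) :
    empiricalCov (actSample g X) = g * empiricalCov X * gᵀ := by
  simp only [empiricalCov_eq, dataMatrix_actSample, Matrix.transpose_mul,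
    Matrix.transpose_transpose, Matrix.mul_smul, Matrix.smul_mul, Matrix.mul_assoc]

lemma actSample_actSample (g h : Matrix (Fin d) (Fin d) ℝ) (X : Sample n d) :
    actSample g (actSample h X) = actSample (g * h) X :=
  dataMatrix_injective <| by
    simp only [dataMatrix_actSample, Matrix.transpose_mul, Matrix.mul_assoc]

lemma mixSample_mixSample (o p : Matrix (Fin n) (Fin n) ℝ) (X : Sample n d) :
    mixSample o (mixSample p X) = mixSample (o * p) X :=
  dataMatrix_injective <| by simp only [dataMatrix_mixSample, Matrix.mul_assoc]

lemma mixSample_actSample (o : Matrix (Fin n) (Fin n) ℝ) (g : Matrix (Fin d) (Fin d) ℝ)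
    (X : Sample n d) : mixSample o (actSample g X) = actSample g (mixSample o X) :=
  dataMatrix_injective <| by
    simp only [dataMatrix_mixSample, dataMatrix_actSample, Matrix.mul_assoc]

lemma exists_mixSample_eq {X Y : Sample n d} (h : empiricalCov X = empiricalCov Y) :
    ∃ o ∈ Matrix.orthogonalGroup (Fin n) ℝ, mixSample o X = Y := by
  have gram_eq : (dataMatrix X)ᵀ * dataMatrix X = (dataMatrix Y)ᵀ * dataMatrix Y := by
    rcases n.eq_zero_or_pos with rfl | hn
    · rw [Subsingleton.elim X Y]
    · rw [empiricalCov_eq, empiricalCov_eq] at h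
      exact smul_right_injective _ (inv_ne_zero (Nat.cast_ne_zero.2 hn.ne')) h
  obtain ⟨o, ho, hoX⟩ := exists_mem_orthogonalGroup_mul_eq gram_eq
  exact ⟨o, ho, dataMatrix_injective ((dataMatrix_mixSample o X).trans hoX)⟩

/-! ### The law of the sample -/

instance : IsProbabilityMeasure (sampleLaw n S) := by
  unfold sampleLaw; infer_instance

lemma measurable_actSample (g : Matrix (Fin d) (Fin d) ℝ) :
    Measurable (actSample g : Sample n d → Sample n d) :=
  measurable_pi_lambda _ fun k =>
    (Matrix.toEuclideanCLM (n := Fin d) (𝕜 := ℝ) g).continuous.measurable.comp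
      (measurable_pi_apply k)

lemma measurable_mixSample (o : Matrix (Fin n) (Fin n) ℝ) :
    Measurable (mixSample o : Sample n d → Sample n d) :=
  measurable_pi_lambda _ fun _ => by unfold mixSample; fun_prop

lemma map_toEuclideanCLM_multivariateGaussian (hS : S.PosSemidef)
    (g : Matrix (Fin d) (Fin d) ℝ) :
    (multivariateGaussian 0 S).map (Matrix.toEuclideanCLM (n := Fin d) (𝕜 := ℝ) g) =
      multivariateGaussian 0 (g * S * gᵀ) := by
  apply IsGaussian.ext
  · simp only [id_eq, integral_id_multivariateGaussian]
    rw [ContinuousLinearMap.integral_id_map, integral_id_multivariateGaussian, map_zero]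
    exact IsGaussian.integrable_id
  · have adjoint_eq : (Matrix.toEuclideanCLM (n := Fin d) (𝕜 := ℝ) g).adjoint =
        Matrix.toEuclideanCLM (n := Fin d) (𝕜 := ℝ) gᵀ := by
      rw [← ContinuousLinearMap.star_eq_adjoint, ← map_star, Matrix.star_eq_conjTranspose,
        Matrix.conjTranspose_eq_transpose_of_trivial]
    ext x y
    rw [covarianceBilin_map IsGaussian.memLp_two_id, covarianceBilin_multivariateGaussian hS,
      covarianceBilin_multivariateGaussian (posSemidef_mul_mul_transpose hS g), adjoint_eq,
      Matrix.ofLp_toEuclideanCLM, Matrix.ofLp_toEuclideanCLM, Matrix.mulVec_mulVec,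
      Matrix.dotProduct_mulVec, Matrix.mulVec_transpose, Matrix.vecMul_vecMul,
      Matrix.dotProduct_mulVec, Matrix.mul_assoc]

lemma map_actSample_sampleLaw (hS : S.PosSemidef) (g : Matrix (Fin d) (Fin d) ℝ) :
    (sampleLaw n S).map (actSample g) = sampleLaw n (g * S * gᵀ) := by
  have h := Measure.pi_map_pi (μ := fun _ : Fin n => multivariateGaussian 0 S)
    (f := fun _ => Matrix.toEuclideanCLM (n := Fin d) (𝕜 := ℝ) g)
    (hμ := fun _ => by rw [map_toEuclideanCLM_multivariateGaussian hS]; infer_instance)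
    (fun _ => (ContinuousLinearMap.continuous _).aemeasurable)
  simp only [map_toEuclideanCLM_multivariateGaussian hS] at h
  exact h

lemma map_toLp_pi_stdGaussian {ι E : Type*} [Fintype ι] [NormedAddCommGroup E]
    [InnerProductSpace ℝ E] [FiniteDimensional ℝ E] [MeasurableSpace E] [BorelSpace E] :
    (Measure.pi fun _ : ι => stdGaussian E).map (WithLp.toLp 2) =
      stdGaussian (PiLp 2 fun _ : ι => E) := by
  have := FiniteDimensional.proper_real E
  apply Measure.ext_of_charFun (E := PiLp 2 fun _ : ι => E)
  ext t
  simp_rw [charFun_stdGaussian, charFun_pi, charFun_stdGaussian, ← Complex.exp_sum,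
    ← Complex.ofReal_pow, PiLp.norm_sq_eq_of_L2]
  simp [Finset.sum_div, neg_div]

lemma sum_norm_sq_mixSample {o : Matrix (Fin n) (Fin n) ℝ}
    (ho : o ∈ Matrix.orthogonalGroup (Fin n) ℝ) (X : Sample n d) :
    ∑ k, ‖mixSample o X k‖ ^ 2 = ∑ k, ‖X k‖ ^ 2 := by
  have trace_gram (X : Sample n d) :
      ∑ k, ‖X k‖ ^ 2 = ((dataMatrix X)ᵀ * dataMatrix X).trace := by
    simp only [EuclideanSpace.real_norm_sq_eq, Matrix.trace, Matrix.diag_apply, Matrix.mul_apply,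
      Matrix.transpose_apply, dataMatrix, Matrix.of_apply, ← sq]
    exact Finset.sum_comm
  rw [trace_gram, trace_gram, dataMatrix_mixSample, Matrix.transpose_mul, Matrix.mul_assoc,
    ← Matrix.mul_assoc oᵀ, transpose_mul_of_mem_orthogonalGroup ho, Matrix.one_mul]

lemma map_mixSample_sampleLaw_one {o : Matrix (Fin n) (Fin n) ℝ}
    (ho : o ∈ Matrix.orthogonalGroup (Fin n) ℝ) :
    (sampleLaw n (1 : Matrix (Fin d) (Fin d) ℝ)).map (mixSample o) = sampleLaw n 1 := by
  let L : PiLp 2 (fun _ : Fin n => EuclideanSpace ℝ (Fin d)) →ₗᵢ[ℝ]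
      PiLp 2 (fun _ : Fin n => EuclideanSpace ℝ (Fin d)) :=
    { toFun := fun X => WithLp.toLp 2 (mixSample o X.ofLp)
      map_add' := fun X Y => by ext; simp [mixSample, Finset.sum_add_distrib]
      map_smul' := fun c X => by ext; simp [mixSample, Finset.mul_sum, mul_left_comm]
      norm_map' := fun X => by
        rw [← pow_left_inj₀ (norm_nonneg _) (norm_nonneg _) two_ne_zero, PiLp.norm_sq_eq_of_L2,
          PiLp.norm_sq_eq_of_L2]
        exact sum_norm_sq_mixSample ho X.ofLp }
  have invariant := stdGaussian_map (L.toLinearIsometryEquiv rfl)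
  rw [← map_toLp_pi_stdGaussian, Measure.map_map (by fun_prop) (by fun_prop)] at invariant
  have h := congrArg (Measure.map WithLp.ofLp) invariant
  rw [Measure.map_map (by fun_prop) (by fun_prop), Measure.map_map (by fun_prop) (by fun_prop)] at h
  simp only [sampleLaw, multivariateGaussian_zero_one]
  simpa [Function.comp_def, L, Measure.map_id'] using h

lemma map_mixSample_sampleLaw {o : Matrix (Fin n) (Fin n) ℝ}
    (ho : o ∈ Matrix.orthogonalGroup (Fin n) ℝ) (hS : S.PosSemidef) :
    (sampleLaw n S).map (mixSample o) = sampleLaw n S := by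
  obtain ⟨C, rfl⟩ := exists_eq_transpose_mul_self hS
  have law_eq := map_actSample_sampleLaw (n := n) Matrix.PosSemidef.one Cᵀ
  rw [Matrix.mul_one, Matrix.transpose_transpose] at law_eq
  rw [← law_eq, Measure.map_map (measurable_mixSample _) (measurable_actSample _),
    show mixSample o ∘ actSample Cᵀ = actSample Cᵀ ∘ mixSample (d := d) o from
      funext (mixSample_actSample o Cᵀ),
    ← Measure.map_map (measurable_actSample _) (measurable_mixSample _),
    map_mixSample_sampleLaw_one ho]

lemma absolutelyContinuous_pi_fin {α : Type*} [MeasurableSpace α] :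
    ∀ {k : ℕ} (μ ν : Fin k → Measure α) [∀ i, SigmaFinite (μ i)] [∀ i, SigmaFinite (ν i)],
      (∀ i, μ i ≪ ν i) → Measure.pi μ ≪ Measure.pi ν := by
  intro k
  induction k with
  | zero =>
    intro μ ν _ _ _
    rw [Measure.pi_of_empty, Measure.pi_of_empty]
  | succ k ih =>
    intro μ ν _ _ h
    have prod_ac : (μ 0).prod (Measure.pi fun j => μ (Fin.succAbove 0 j)) ≪
        (ν 0).prod (Measure.pi fun j => ν (Fin.succAbove 0 j)) :=
      (h 0).prod (ih _ _ fun i => h _)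
    rw [← (measurePreserving_piFinSuccAbove μ 0).map_eq,
      ← (measurePreserving_piFinSuccAbove ν 0).map_eq] at prod_ac
    simpa only [MeasurableEquiv.map_symm_map] using
      prod_ac.map (MeasurableEquiv.piFinSuccAbove (fun _ => α) 0).symm.measurable

lemma stdGaussian_absolutelyContinuous : stdGaussian (EuclideanSpace ℝ (Fin d)) ≪ volume := by
  rw [← map_pi_eq_stdGaussian, ← (PiLp.volume_preserving_toLp (Fin d)).map_eq]
  exact (absolutelyContinuous_pi_fin _ _ fun _ =>
    gaussianReal_absolutelyContinuous 0 one_ne_zero).map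
      (PiLp.volume_preserving_toLp (Fin d)).measurable

lemma absolutelyContinuous_stdGaussian :
    (volume : Measure (EuclideanSpace ℝ (Fin d))) ≪ stdGaussian (EuclideanSpace ℝ (Fin d)) := by
  rw [← map_pi_eq_stdGaussian, ← (PiLp.volume_preserving_toLp (Fin d)).map_eq]
  exact (absolutelyContinuous_pi_fin _ _ fun _ =>
    gaussianReal_absolutelyContinuous' 0 one_ne_zero).map
      (PiLp.volume_preserving_toLp (Fin d)).measurable

lemma multivariateGaussian_absolutelyContinuous (hS : S.PosDef) :
    multivariateGaussian 0 S ≪ stdGaussian (EuclideanSpace ℝ (Fin d)) := by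
  obtain ⟨C, rfl⟩ := exists_eq_transpose_mul_self hS.posSemidef
  have det_ne_zero : LinearMap.det (Matrix.toEuclideanCLM (n := Fin d) (𝕜 := ℝ) Cᵀ :
      EuclideanSpace ℝ (Fin d) →ₗ[ℝ] EuclideanSpace ℝ (Fin d)) ≠ 0 := by
    rw [Matrix.coe_toEuclideanCLM_eq_toEuclideanLin, LinearMap.det_toLpLin]
    exact left_ne_zero_of_mul (Matrix.det_mul Cᵀ C ▸ hS.det_pos.ne')
  have quasi := Measure.LinearMap.quasiMeasurePreserving
    (volume : Measure (EuclideanSpace ℝ (Fin d))) _ det_ne_zero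
  have law_eq := map_toEuclideanCLM_multivariateGaussian Matrix.PosSemidef.one Cᵀ
  rw [Matrix.mul_one, Matrix.transpose_transpose, multivariateGaussian_zero_one] at law_eq
  rw [← law_eq]
  exact ((stdGaussian_absolutelyContinuous.map quasi.measurable).trans
    quasi.absolutelyContinuous).trans absolutelyContinuous_stdGaussian

lemma sampleLaw_absolutelyContinuous (hS : S.PosDef) : sampleLaw n S ≪ sampleLaw n 1 :=
  absolutelyContinuous_pi_fin _ _ fun _ => by
    rw [multivariateGaussian_zero_one]
    exact multivariateGaussian_absolutelyContinuous hS

end Samples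

/-! ### Averaging precision matrices -/

section Measurability

variable {α k m : Type*} [MeasurableSpace α]

instance : MeasurableSpace (Matrix k m ℝ) :=
  inferInstanceAs (MeasurableSpace (k → m → ℝ))

instance [Countable k] [Countable m] : BorelSpace (Matrix k m ℝ) :=
  inferInstanceAs (BorelSpace (k → m → ℝ))

instance [Countable k] [Countable m] : SecondCountableTopology (Matrix k m ℝ) :=
  inferInstanceAs (SecondCountableTopology (k → m → ℝ))

lemma measurable_matrix_iff {A : α → Matrix k m ℝ} :
    Measurable A ↔ ∀ i j, Measurable fun x => A x i j :=
  measurable_pi_iff.trans (forall_congr' fun _ => measurable_pi_iff)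

variable [Fintype m] [DecidableEq m]

lemma measurable_matrix_inv : Measurable fun A : Matrix m m ℝ => A⁻¹ := by
  simp only [Matrix.inv_def, Ring.inverse_eq_inv']
  exact continuous_id.matrix_det.measurable.inv.smul continuous_id.matrix_adjugate.measurable

lemma measurable_entropyLoss {d : ℕ} (S : Matrix (Fin d) (Fin d) ℝ) :
    Measurable fun A => entropyLoss A S := by
  have inv_mul : Measurable fun A : Matrix (Fin d) (Fin d) ℝ => A⁻¹ * S :=
    measurable_matrix_inv.mul_const S
  exact ((continuous_id.matrix_trace.measurable.comp inv_mul).sub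
    (continuous_id.matrix_det.measurable.comp inv_mul).log).sub_const _

lemma Estimator.measurable {n d : ℕ} {B : ℝ} (δ : Estimator n d B) : Measurable δ.est :=
  measurable_matrix_iff.2 δ.measurable_est

end Measurability

section MatrixIntegral

variable {Ω m : Type*} [MeasurableSpace Ω] [Fintype m] [DecidableEq m] {μ : Measure Ω}
  {P : Ω → Matrix m m ℝ}

lemma integrable_trace_mul (hP : Integrable P μ) (C : Matrix m m ℝ) :
    Integrable (fun ω => (P ω * C).trace) μ :=
  (Matrix.traceLinearMap m ℝ ℝ ∘ₗ LinearMap.mulRight ℝ C).toContinuousLinearMap.integrable_comp hP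

lemma integral_trace_mul (hP : Integrable P μ) (C : Matrix m m ℝ) :
    ∫ ω, (P ω * C).trace ∂μ = ((∫ ω, P ω ∂μ) * C).trace :=
  (Matrix.traceLinearMap m ℝ ℝ ∘ₗ
    LinearMap.mulRight ℝ C).toContinuousLinearMap.integral_comp_comm hP

lemma integrable_mul_mul (hP : Integrable P μ) (C D : Matrix m m ℝ) :
    Integrable (fun ω => C * P ω * D) μ :=
  (LinearMap.mulLeftRight ℝ (C, D)).toContinuousLinearMap.integrable_comp hP

lemma integral_mul_mul (hP : Integrable P μ) (C D : Matrix m m ℝ) :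
    ∫ ω, C * P ω * D ∂μ = C * (∫ ω, P ω ∂μ) * D :=
  (LinearMap.mulLeftRight ℝ (C, D)).toContinuousLinearMap.integral_comp_comm hP

lemma integrable_mul_mul_iff {C D : Matrix m m ℝ} (hC : IsUnit C)
    (hD : IsUnit D) : Integrable (fun ω => C * P ω * D) μ ↔ Integrable P μ := by
  refine ⟨fun h => ?_, fun h => integrable_mul_mul h C D⟩
  rw [Matrix.isUnit_iff_isUnit_det] at hC hD
  convert integrable_mul_mul h C⁻¹ D⁻¹ using 2
  rw [Matrix.mul_assoc, Matrix.mul_assoc, Matrix.mul_assoc, Matrix.mul_nonsing_inv _ hD,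
    Matrix.mul_one, Matrix.nonsing_inv_mul_cancel_left _ _ hC]

lemma posSemidef_integral [IsProbabilityMeasure μ] (hP : Integrable P μ)
    (hpos : ∀ ω, (P ω).PosSemidef) : (∫ ω, P ω ∂μ).PosSemidef := by
  have convex : Convex ℝ {M : Matrix m m ℝ | M.PosSemidef} :=
    fun _ hM _ hN _ _ ha hb _ => (hM.smul ha).add (hN.smul hb)
  exact convex.integral_mem isClosed_setOf_posSemidef (.of_forall hpos) hP

end MatrixIntegral

section Average

variable {Ω : Type*} [MeasurableSpace Ω] {d : ℕ} {B : ℝ} {μ : Measure Ω}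
  {A : Ω → Matrix (Fin d) (Fin d) ℝ} {S : Matrix (Fin d) (Fin d) ℝ}

/-- The estimate whose precision matrix is the mean of the precision matrices of the random
estimate `A`, or `B • 1` if this mean does not exist. -/
def averageEstimate (B : ℝ) (μ : Measure Ω) (A : Ω → Matrix (Fin d) (Fin d) ℝ) :
    Matrix (Fin d) (Fin d) ℝ :=
  open Classical in
  if Integrable (fun ω => (A ω)⁻¹) μ then (∫ ω, (A ω)⁻¹ ∂μ)⁻¹ else B • 1

lemma averageEstimate_of_integrable (h : Integrable (fun ω => (A ω)⁻¹) μ) :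
    averageEstimate B μ A = (∫ ω, (A ω)⁻¹ ∂μ)⁻¹ := if_pos h

lemma averageEstimate_of_not_integrable (h : ¬Integrable (fun ω => (A ω)⁻¹) μ) :
    averageEstimate B μ A = B • 1 := if_neg h

lemma inv_integral_inv_mem_paramSpace [IsProbabilityMeasure μ] (hB : 0 < B)
    (hA : ∀ ω, A ω ∈ paramSpace d B) (h : Integrable (fun ω => (A ω)⁻¹) μ) :
    (∫ ω, (A ω)⁻¹ ∂μ)⁻¹ ∈ paramSpace d B := by
  have sub_posSemidef : (∫ ω, (A ω)⁻¹ ∂μ - B⁻¹ • 1).PosSemidef := by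
    have := posSemidef_integral (h.sub (integrable_const (B⁻¹ • 1)))
      fun ω => ((mem_paramSpace_iff_inv hB).1 (hA ω)).2
    rwa [integral_sub' h (integrable_const _), integral_const, probReal_univ, one_smul] at this
  have posDef : (∫ ω, (A ω)⁻¹ ∂μ).PosDef := by
    simpa only [sub_add_cancel] using
      Matrix.PosDef.posSemidef_add sub_posSemidef (Matrix.PosDef.one.smul (inv_pos.2 hB))
  refine (mem_paramSpace_iff_inv hB).2 ⟨posDef.inv, ?_⟩
  rwa [Matrix.nonsing_inv_nonsing_inv _ posDef.det_pos.ne'.isUnit]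

lemma averageEstimate_mem [IsProbabilityMeasure μ] (hB : 0 < B)
    (hA : ∀ ω, A ω ∈ paramSpace d B) : averageEstimate B μ A ∈ paramSpace d B := by
  by_cases h : Integrable (fun ω => (A ω)⁻¹) μ
  · rw [averageEstimate_of_integrable h]
    exact inv_integral_inv_mem_paramSpace hB hA h
  · rw [averageEstimate_of_not_integrable h]
    exact smul_one_mem_paramSpace hB

lemma integrable_entropyLoss (hS : S.PosDef) (hmeas : Measurable A) (hA : ∀ ω, (A ω).PosDef)
    (h : ∫⁻ ω, ENNReal.ofReal (entropyLoss (A ω) S) ∂μ ≠ ∞) :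
    Integrable (fun ω => entropyLoss (A ω) S) μ :=
  ⟨((measurable_entropyLoss S).comp hmeas).aestronglyMeasurable,
    (hasFiniteIntegral_iff_ofReal (.of_forall fun ω => entropyLoss_nonneg (hA ω) hS)).2 h.lt_top⟩

lemma integrable_inv_of_integrable_entropyLoss [IsFiniteMeasure μ] (hS : S.PosDef)
    (hmeas : Measurable A) (hA : ∀ ω, (A ω).PosDef)
    (h : Integrable (fun ω => entropyLoss (A ω) S) μ) : Integrable (fun ω => (A ω)⁻¹) μ := by
  obtain ⟨K, rfl⟩ := exists_eq_transpose_mul_self hS.posSemidef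
  have hKt : IsUnit Kᵀ := isUnit_of_mul_isUnit_left hS.isUnit
  have hK : IsUnit K := isUnit_of_mul_isUnit_right hS.isUnit
  rw [← integrable_mul_mul_iff hK hKt]
  refine Integrable.mono' ((h.add (integrable_const (d * Real.log 2))).const_mul 2) ?_
    (.of_forall fun ω => ?_)
  · exact (((measurable_matrix_inv.comp hmeas).const_mul K).mul_const Kᵀ).aestronglyMeasurable
  · calc ‖K * (A ω)⁻¹ * Kᵀ‖ ≤ (K * (A ω)⁻¹ * Kᵀ).trace :=
          norm_le_trace (posSemidef_mul_mul_transpose (hA ω).inv.posSemidef K)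
      _ = ((A ω)⁻¹ * (Kᵀ * K)).trace := by
          rw [Matrix.mul_assoc, Matrix.trace_mul_comm, Matrix.mul_assoc]
      _ ≤ 2 * (entropyLoss (A ω) (Kᵀ * K) + d * Real.log 2) :=
          trace_inv_mul_le_entropyLoss (hA ω) hS

/-- Jensen's inequality for the entropy loss, which is convex in the precision matrix. -/
lemma entropyLoss_inv_integral_inv_le [IsProbabilityMeasure μ] (hS : S.PosDef)
    (hA : ∀ ω, (A ω).PosDef) (hinv : Integrable (fun ω => (A ω)⁻¹) μ)
    (hpos : (∫ ω, (A ω)⁻¹ ∂μ).PosDef) (h : Integrable (fun ω => entropyLoss (A ω) S) μ) :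
    entropyLoss (∫ ω, (A ω)⁻¹ ∂μ)⁻¹ S ≤ ∫ ω, entropyLoss (A ω) S ∂μ := by
  set Q := ∫ ω, (A ω)⁻¹ ∂μ
  have hsub : Integrable (fun ω => (A ω)⁻¹ - Q) μ := hinv.sub (integrable_const Q)
  have tangent (ω : Ω) :
      entropyLoss Q⁻¹ S + (((A ω)⁻¹ - Q) * (S - Q⁻¹)).trace ≤ entropyLoss (A ω) S := by
    have := entropyLoss_inv_add_trace_le (hA ω).inv hpos hS
    rwa [Matrix.nonsing_inv_nonsing_inv _ (hA ω).det_pos.ne'.isUnit] at this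
  calc entropyLoss Q⁻¹ S
      = ∫ ω, (entropyLoss Q⁻¹ S + (((A ω)⁻¹ - Q) * (S - Q⁻¹)).trace) ∂μ := by
        rw [integral_add (integrable_const _) (integrable_trace_mul hsub _),
          integral_trace_mul hsub, integral_sub hinv (integrable_const _)]
        simp [Q]
    _ ≤ ∫ ω, entropyLoss (A ω) S ∂μ :=
        integral_mono ((integrable_const _).add (integrable_trace_mul hsub _)) h tangent

lemma entropyLoss_averageEstimate_le [IsProbabilityMeasure μ] (hB : 0 < B) (hS : S.PosDef)
    (hmeas : Measurable A) (hA : ∀ ω, A ω ∈ paramSpace d B) :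
    ENNReal.ofReal (entropyLoss (averageEstimate B μ A) S) ≤
      ∫⁻ ω, ENNReal.ofReal (entropyLoss (A ω) S) ∂μ := by
  by_cases hfin : ∫⁻ ω, ENNReal.ofReal (entropyLoss (A ω) S) ∂μ = ∞
  · exact hfin ▸ le_top
  have hpos (ω : Ω) := (hA ω).1
  have hL := integrable_entropyLoss hS hmeas hpos hfin
  have hinv := integrable_inv_of_integrable_entropyLoss hS hmeas hpos hL
  rw [averageEstimate_of_integrable hinv, ← ofReal_integral_eq_lintegral_ofReal hL
    (.of_forall fun ω => entropyLoss_nonneg (hpos ω) hS)]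
  exact ENNReal.ofReal_le_ofReal (entropyLoss_inv_integral_inv_le hS hpos hinv
    (Matrix.posDef_inv_iff.1 (inv_integral_inv_mem_paramSpace hB hA hinv).1) hL)

lemma averageEstimate_mul_mul_transpose {g : Matrix (Fin d) (Fin d) ℝ}
    (hg : g ∈ Matrix.orthogonalGroup (Fin d) ℝ) :
    averageEstimate B μ (fun ω => g * A ω * gᵀ) = g * averageEstimate B μ A * gᵀ := by
  have integrable_iff :
      Integrable (fun ω => (g * A ω * gᵀ)⁻¹) μ ↔ Integrable (fun ω => (A ω)⁻¹) μ := by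
    simp only [inv_mul_mul_transpose hg]
    exact integrable_mul_mul_iff (isUnit_of_mem_orthogonalGroup hg)
      (isUnit_of_mem_orthogonalGroup (transpose_mem_orthogonalGroup hg))
  by_cases h : Integrable (fun ω => (A ω)⁻¹) μ
  · rw [averageEstimate_of_integrable h, averageEstimate_of_integrable (integrable_iff.2 h)]
    simp only [inv_mul_mul_transpose hg]
    rw [integral_mul_mul h, inv_mul_mul_transpose hg]
  · rw [averageEstimate_of_not_integrable h, averageEstimate_of_not_integrable
      (integrable_iff.not.2 h), Matrix.mul_smul, Matrix.smul_mul, Matrix.mul_one,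
      mul_transpose_of_mem_orthogonalGroup hg]

lemma averageEstimate_comp {Ω' : Type*} [MeasurableSpace Ω'] {ν : Measure Ω'} {φ : Ω' → Ω}
    (hφ : MeasurePreserving φ ν μ) (hmeas : Measurable A) :
    averageEstimate B ν (A ∘ φ) = averageEstimate B μ A := by
  have hinv : AEStronglyMeasurable (fun ω => (A ω)⁻¹) μ :=
    (measurable_matrix_inv.comp hmeas).aestronglyMeasurable
  have integrable_iff : Integrable (fun ω => ((A ∘ φ) ω)⁻¹) ν ↔ Integrable (fun ω => (A ω)⁻¹) μ :=
    hφ.integrable_comp hinv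
  have integral_eq : ∫ ω, ((A ∘ φ) ω)⁻¹ ∂ν = ∫ ω, (A ω)⁻¹ ∂μ := by
    rw [← hφ.map_eq] at hinv ⊢
    exact (integral_map hφ.aemeasurable hinv).symm
  rw [averageEstimate, averageEstimate, integral_eq]
  classical exact if_congr integrable_iff rfl rfl

lemma measurable_averageEstimate {α : Type*} [MeasurableSpace α] [SFinite μ]
    {A : Ω → α → Matrix (Fin d) (Fin d) ℝ} (hA : Measurable fun p : Ω × α => A p.1 p.2) :
    Measurable fun x => averageEstimate B μ fun ω => A ω x := by
  have hinv : StronglyMeasurable fun p : α × Ω => (A p.2 p.1)⁻¹ :=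
    ((measurable_matrix_inv.comp hA).comp measurable_swap).stronglyMeasurable
  exact Measurable.ite (measurableSet_integrable hinv)
    (measurable_matrix_inv.comp hinv.integral_prod_right'.measurable) measurable_const

end Average

/-! ### Derandomization and symmetrization -/

section Derandomization

variable {n d : ℕ} {B : ℝ} {C : Set (Estimator n d B)} {S : Matrix (Fin d) (Fin d) ℝ}

lemma RandomizedEstimator.measurable (T : RandomizedEstimator C) :
    Measurable fun p : T.Seed × Sample n d => (T.draw p.1).est p.2 :=
  measurable_matrix_iff.2 T.measurable_draw

lemma RandomizedEstimator.measurable_left (T : RandomizedEstimator C) (X : Sample n d) :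
    Measurable fun ω => (T.draw ω).est X :=
  T.measurable.comp measurable_prodMk_right

lemma RandomizedEstimator.measurable_loss (T : RandomizedEstimator C)
    (S : Matrix (Fin d) (Fin d) ℝ) : Measurable fun p : T.Seed × Sample n d =>
      ENNReal.ofReal (entropyLoss ((T.draw p.1).est p.2) S) :=
  ((measurable_entropyLoss S).comp T.measurable).ennreal_ofReal

lemma RandomizedEstimator.measurable_risk (T : RandomizedEstimator C)
    (S : Matrix (Fin d) (Fin d) ℝ) : Measurable fun ω => (T.draw ω).risk S :=
  (T.measurable_loss S).lintegral_prod_right'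

/-- The deterministic estimator obtained from a randomized estimator by averaging the precision
matrices over the seed. -/
def RandomizedEstimator.derandomize (T : RandomizedEstimator C) (hB : 0 < B) :
    Estimator n d B where
  est X := averageEstimate B T.law fun ω => (T.draw ω).est X
  measurable_est := measurable_matrix_iff.1 (measurable_averageEstimate T.measurable)
  est_mem X := averageEstimate_mem hB fun ω => (T.draw ω).est_mem X

lemma RandomizedEstimator.risk_derandomize_le (T : RandomizedEstimator C) (hB : 0 < B)
    (hS : S.PosDef) : (T.derandomize hB).risk S ≤ T.risk S :=
  calc (T.derandomize hB).risk S
      ≤ ∫⁻ X, ∫⁻ ω, ENNReal.ofReal (entropyLoss ((T.draw ω).est X) S) ∂T.law ∂(sampleLaw n S) :=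
        lintegral_mono fun X => entropyLoss_averageEstimate_le hB hS (T.measurable_left X)
          fun ω => (T.draw ω).est_mem X
    _ = T.risk S :=
        lintegral_lintegral_swap ((T.measurable_loss S).comp measurable_swap).aemeasurable

end Derandomization

section Symmetrization

variable {n d : ℕ} {B : ℝ} {C : Set (Estimator n d B)} {S : Matrix (Fin d) (Fin d) ℝ}

instance : CompactSpace (Matrix.orthogonalGroup (Fin d) ℝ) := by
  refine isCompact_iff_compactSpace.1 <|
    (isCompact_closedBall 0 ‖(1 : Matrix (Fin d) (Fin d) ℝ)‖).of_isClosed_subset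
      (isClosed_unitary (R := Matrix (Fin d) (Fin d) ℝ)) fun g hg => ?_
  rw [mem_closedBall_zero_iff, ← mul_one g, CStarRing.norm_mem_unitary_mul _ hg]

instance : BorelSpace (Matrix.orthogonalGroup (Fin d) ℝ) :=
  Subtype.borelSpace (Matrix.orthogonalGroup (Fin d) ℝ : Set (Matrix (Fin d) (Fin d) ℝ))

instance : SecondCountableTopology (Matrix.orthogonalGroup (Fin d) ℝ) :=
  TopologicalSpace.Subtype.secondCountableTopology
    (Matrix.orthogonalGroup (Fin d) ℝ : Set (Matrix (Fin d) (Fin d) ℝ))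

/-- An estimator that is equivariant under orthogonal transformations of `ℝ^d` and invariant under
orthogonal mixings of the observations. -/
def Estimator.IsEquivariant (δ : Estimator n d B) : Prop :=
  δ ∈ invariantEstimators n d B ∧
    ∀ o ∈ Matrix.orthogonalGroup (Fin n) ℝ, ∀ X, δ.est (mixSample o X) = δ.est X

/-- The group of orthogonal transformations of `ℝ^d` and orthogonal mixings of the `n`
observations. -/
abbrev SampleGroup (n d : ℕ) : Type :=
  Matrix.orthogonalGroup (Fin d) ℝ × Matrix.orthogonalGroup (Fin n) ℝ

/-- The Haar probability measure of `SampleGroup n d`. -/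
abbrev sampleHaar (n d : ℕ) : Measure (SampleGroup n d) := Measure.haarMeasure ⊤

instance : IsProbabilityMeasure (sampleHaar n d) :=
  ⟨Measure.haarMeasure_self (K₀ := (⊤ : TopologicalSpace.PositiveCompacts (SampleGroup n d)))⟩

/-- The action of `a = (g, o)` on estimators, whose fixed points are the equivariant estimators:
transform the data by `a⁻¹`, estimate, and transform the estimate back by `g`. -/
def Estimator.conjugate (δ : Estimator n d B) (a : SampleGroup n d) : Estimator n d B where
  est X := a.1.1 * δ.est (actSample a.1.1ᵀ (mixSample a.2.1ᵀ X)) * a.1.1ᵀ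
  measurable_est := measurable_matrix_iff.1 <| ((δ.measurable.comp
    ((measurable_actSample _).comp (measurable_mixSample _))).const_mul a.1.1).mul_const a.1.1ᵀ
  est_mem _ := mul_mul_transpose_mem_paramSpace (δ.est_mem _) a.1.2

lemma Estimator.conjugate_est_actSample (δ : Estimator n d B)
    (g : Matrix.orthogonalGroup (Fin d) ℝ) (a : SampleGroup n d) (X : Sample n d) :
    (δ.conjugate a).est (actSample g.1 X) =
      g.1 * (δ.conjugate ((g, 1)⁻¹ * a)).est X * g.1ᵀ := by
  have coe_inv_mul : (g⁻¹ * a.1).1 = g.1ᵀ * a.1.1 := rfl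
  simp only [conjugate, Prod.fst_mul, Prod.snd_mul, Prod.fst_inv, Prod.snd_inv, inv_one,
    one_mul, coe_inv_mul, mixSample_actSample, actSample_actSample, Matrix.transpose_mul,
    Matrix.transpose_transpose, Matrix.mul_assoc, mul_transpose_of_mem_orthogonalGroup g.2,
    Matrix.mul_one]
  rw [← Matrix.mul_assoc g.1 g.1ᵀ, mul_transpose_of_mem_orthogonalGroup g.2, Matrix.one_mul]

lemma Estimator.conjugate_est_mixSample (δ : Estimator n d B)
    (o : Matrix.orthogonalGroup (Fin n) ℝ) (a : SampleGroup n d) (X : Sample n d) :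
    (δ.conjugate a).est (mixSample o.1 X) = (δ.conjugate ((1, o)⁻¹ * a)).est X := by
  have coe_inv_mul : (o⁻¹ * a.2).1 = o.1ᵀ * a.2.1 := rfl
  simp only [conjugate, Prod.fst_mul, Prod.snd_mul, Prod.fst_inv, Prod.snd_inv, inv_one,
    one_mul, coe_inv_mul, mixSample_mixSample, Matrix.transpose_mul, Matrix.transpose_transpose]

lemma Estimator.risk_conjugate (δ : Estimator n d B) (a : SampleGroup n d) (hS : S.PosDef) :
    (δ.conjugate a).risk S = δ.risk (a.1.1ᵀ * S * a.1.1) := by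
  have ha := transpose_mem_orthogonalGroup a.1.2
  have loss_eq (X : Sample n d) : entropyLoss ((δ.conjugate a).est X) S =
      entropyLoss (δ.est (actSample a.1.1ᵀ (mixSample a.2.1ᵀ X))) (a.1.1ᵀ * S * a.1.1) := by
    have h := entropyLoss_mul_mul_transpose ha ((δ.conjugate a).est X) S
    rw [Matrix.transpose_transpose] at h
    rw [← h, conjugate, transpose_mul_mul_transpose_mul a.1.2]
  have hmeas : Measurable fun Y : Sample n d =>
      ENNReal.ofReal (entropyLoss (δ.est Y) (a.1.1ᵀ * S * a.1.1)) :=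
    ((measurable_entropyLoss _).comp δ.measurable).ennreal_ofReal
  have hlaw := map_actSample_sampleLaw (n := n) hS.posSemidef a.1.1ᵀ
  rw [Matrix.transpose_transpose] at hlaw
  simp only [Estimator.risk, loss_eq]
  rw [← hlaw, lintegral_map hmeas (measurable_actSample _), ← lintegral_map
    (f := fun Y => ENNReal.ofReal (entropyLoss (δ.est (actSample a.1.1ᵀ Y)) (a.1.1ᵀ * S * a.1.1)))
    (hmeas.comp (measurable_actSample _)) (measurable_mixSample _),
    map_mixSample_sampleLaw (transpose_mem_orthogonalGroup a.2.2) hS.posSemidef]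

lemma continuous_actSample_mixSample :
    Continuous fun p : SampleGroup n d × Sample n d =>
      actSample p.1.1.1ᵀ (mixSample p.1.2.1ᵀ p.2) := by
  have hg : Continuous fun p : SampleGroup n d × Sample n d => p.1.1.1 := by fun_prop
  have ho : Continuous fun p : SampleGroup n d × Sample n d => p.1.2.1 := by fun_prop
  refine continuous_pi fun k => (PiLp.continuous_toLp 2 _).comp ?_
  refine Continuous.matrix_mulVec hg.matrix_transpose ((PiLp.continuous_ofLp 2 _).comp ?_)
  exact continuous_finsetSum _ fun l _ => (ho.matrix_elem l k).smul (by fun_prop)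

lemma RandomizedEstimator.measurable_conjugate_est (T : RandomizedEstimator C) :
    Measurable fun q : (T.Seed × SampleGroup n d) × Sample n d =>
      ((T.draw q.1.1).conjugate q.1.2).est q.2 := by
  have hg : Measurable fun q : (T.Seed × SampleGroup n d) × Sample n d => q.1.2.1.1 := by
    fun_prop
  have hest : Measurable fun q : (T.Seed × SampleGroup n d) × Sample n d =>
      (T.draw q.1.1).est (actSample q.1.2.1.1ᵀ (mixSample q.1.2.2.1ᵀ q.2)) :=
    T.measurable.comp (measurable_fst.fst.prodMk (continuous_actSample_mixSample.measurable.comp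
      (measurable_fst.snd.prodMk measurable_snd)))
  exact (hg.mul hest).mul (continuous_id.matrix_transpose.measurable.comp hg)

/-- The randomized estimator that conjugates `T` by a Haar distributed group element. -/
def RandomizedEstimator.conjugate (T : RandomizedEstimator C) :
    RandomizedEstimator (Set.univ : Set (Estimator n d B)) where
  Seed := T.Seed × SampleGroup n d
  law := T.law.prod (sampleHaar n d)
  draw p := (T.draw p.1).conjugate p.2
  draw_mem _ := Set.mem_univ _
  measurable_draw := measurable_matrix_iff.1 T.measurable_conjugate_est

lemma RandomizedEstimator.risk_conjugate_le (T : RandomizedEstimator C) {c : ℝ≥0∞}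
    (hT : ∀ S ∈ paramSpace d B, T.risk S ≤ c) (hS : S ∈ paramSpace d B) :
    T.conjugate.risk S ≤ c := by
  have conj_mem (a : SampleGroup n d) : a.1.1ᵀ * S * a.1.1 ∈ paramSpace d B := by
    simpa only [Matrix.transpose_transpose] using
      mul_mul_transpose_mem_paramSpace hS (transpose_mem_orthogonalGroup a.1.2)
  calc T.conjugate.risk S
      = ∫⁻ a, ∫⁻ ω, ((T.draw ω).conjugate a).risk S ∂T.law ∂(sampleHaar n d) :=
        lintegral_prod_symm _ (T.conjugate.measurable_risk S).aemeasurable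
    _ = ∫⁻ a, T.risk (a.1.1ᵀ * S * a.1.1) ∂(sampleHaar n d) := by
        simp only [Estimator.risk_conjugate _ _ hS.1, RandomizedEstimator.risk]
    _ ≤ ∫⁻ _, c ∂(sampleHaar n d) := lintegral_mono fun a => hT _ (conj_mem a)
    _ = c := by rw [lintegral_const, measure_univ, mul_one]

lemma RandomizedEstimator.measurable_conjugate_est_left (T : RandomizedEstimator C)
    (X : Sample n d) :
    Measurable fun p : T.Seed × SampleGroup n d => ((T.draw p.1).conjugate p.2).est X :=
  T.conjugate.measurable_left X

lemma measurePreserving_mul_left_snd {α : Type*} [MeasurableSpace α] (ν : Measure α) [SFinite ν]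
    (b : SampleGroup n d) :
    MeasurePreserving (fun p : α × SampleGroup n d => (p.1, b * p.2))
      (ν.prod (sampleHaar n d)) (ν.prod (sampleHaar n d)) :=
  (MeasurePreserving.id ν).prod (measurePreserving_mul_left (sampleHaar n d) b)

/-- By invariance of the Haar measure, the seed of `T.conjugate` may be translated by any group
element. -/
lemma RandomizedEstimator.averageEstimate_conjugate_mul (T : RandomizedEstimator C)
    (b : SampleGroup n d) (X : Sample n d) :
    averageEstimate B (T.law.prod (sampleHaar n d))
        (fun p => ((T.draw p.1).conjugate (b * p.2)).est X) =
      averageEstimate B (T.law.prod (sampleHaar n d))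
        fun p => ((T.draw p.1).conjugate p.2).est X := by
  have h := averageEstimate_comp (B := B) (measurePreserving_mul_left_snd T.law b)
    (T.measurable_conjugate_est_left X)
  exact h

lemma RandomizedEstimator.isEquivariant_derandomize_conjugate (T : RandomizedEstimator C)
    (hB : 0 < B) : (T.conjugate.derandomize hB).IsEquivariant := by
  have est_eq (X : Sample n d) : (T.conjugate.derandomize hB).est X =
      averageEstimate B (T.law.prod (sampleHaar n d))
        fun p => ((T.draw p.1).conjugate p.2).est X := rfl
  refine ⟨fun g hg X => ?_, fun o ho X => ?_⟩
  · rw [est_eq, est_eq, ← T.averageEstimate_conjugate_mul (⟨g, hg⟩, 1)⁻¹ X,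
      ← averageEstimate_mul_mul_transpose hg]
    exact congrArg _ (funext fun p => (T.draw p.1).conjugate_est_actSample ⟨g, hg⟩ p.2 X)
  · rw [est_eq, est_eq, ← T.averageEstimate_conjugate_mul (1, ⟨o, ho⟩)⁻¹ X]
    exact congrArg _ (funext fun p => (T.draw p.1).conjugate_est_mixSample ⟨o, ho⟩ p.2 X)

lemma exists_isEquivariant_risk_le (hB : 0 < B) (T : RandomizedEstimator C) {c : ℝ≥0∞}
    (hT : ∀ S ∈ paramSpace d B, T.risk S ≤ c) :
    ∃ δ : Estimator n d B, δ.IsEquivariant ∧ ∀ S ∈ paramSpace d B, δ.risk S ≤ c :=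
  ⟨T.conjugate.derandomize hB, T.isEquivariant_derandomize_conjugate hB, fun _ hS =>
    (T.conjugate.risk_derandomize_le hB hS.1).trans (T.risk_conjugate_le hT hS)⟩

end Symmetrization

/-! ### Harmonic means -/

section HarmonicMean

variable {m : Type*} [Fintype m] [DecidableEq m]

/-- The harmonic mean of two matrices, that is, the midpoint in the precision matrix, in which the
entropy loss is convex. -/
def harmonicMean (A C : Matrix m m ℝ) : Matrix m m ℝ :=
  ((2 : ℝ)⁻¹ • (A⁻¹ + C⁻¹))⁻¹

lemma harmonicMean_eq {A C : Matrix m m ℝ} (hA : A.PosDef) (hC : C.PosDef) :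
    harmonicMean A C = (2 : ℝ) • (C * (A + C)⁻¹ * A) := by
  have hA' : IsUnit A.det := hA.det_pos.ne'.isUnit
  have hC' : IsUnit C.det := hC.det_pos.ne'.isUnit
  have hAC : IsUnit (A + C).det := (hA.add hC).det_pos.ne'.isUnit
  refine Matrix.inv_eq_right_inv ?_
  rw [Matrix.inv_add_inv (iff_of_true hA.isUnit hC.isUnit), smul_mul_smul_comm,
    inv_mul_cancel₀ two_ne_zero, one_smul, Matrix.mul_assoc C,
    ← Matrix.mul_assoc (A⁻¹ * (A + C) * C⁻¹) C, Matrix.nonsing_inv_mul_cancel_right _ _ hC',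
    Matrix.mul_assoc, Matrix.mul_nonsing_inv_cancel_left _ _ hAC, Matrix.nonsing_inv_mul _ hA']

lemma sub_mul_inv_add_mul_sub {A C : Matrix m m ℝ} (hA : A.PosDef) (hC : C.PosDef) :
    (A - C) * (A + C)⁻¹ * (A - C) = A + C - (2 : ℝ) • harmonicMean A C := by
  have hdet : IsUnit (A + C).det := (hA.add hC).det_pos.ne'.isUnit
  have hl : A - C = (A + C) - (2 : ℝ) • C := by module
  have hr : A - C = (2 : ℝ) • A - (A + C) := by module
  calc (A - C) * (A + C)⁻¹ * (A - C)
      = ((A + C) - (2 : ℝ) • C) * (A + C)⁻¹ * ((2 : ℝ) • A - (A + C)) := by rw [← hl, ← hr]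
    _ = A + C - (2 : ℝ) • harmonicMean A C := by
        rw [Matrix.sub_mul, Matrix.mul_nonsing_inv _ hdet, Matrix.sub_mul, Matrix.one_mul,
          Matrix.mul_sub, Matrix.nonsing_inv_mul_cancel_right _ _ hdet, harmonicMean_eq hA hC]
        simp only [Matrix.smul_mul, Matrix.mul_smul]
        module

variable {d : ℕ} {B : ℝ}

lemma norm_sub_sq_le {A C : Matrix (Fin d) (Fin d) ℝ} (hB : 0 < B)
    (hA : A ∈ paramSpace d B) (hC : C ∈ paramSpace d B) :
    ‖A - C‖ ^ 2 ≤ 2 * B * (A.trace + C.trace - 2 * (harmonicMean A C).trace) := by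
  have hsymm : (A - C)ᵀ = A - C := by
    simpa only [Matrix.conjTranspose_eq_transpose_of_trivial] using
      (hA.1.isHermitian.sub hC.1.isHermitian).eq
  have hadd : A + C ∈ paramSpace d (2 * B) :=
    ⟨hA.1.add hC.1, (norm_add_le A C).trans ((add_le_add hA.2 hC.2).trans (two_mul B).ge)⟩
  have hinv := ((mem_paramSpace_iff_inv (mul_pos two_pos hB)).1 hadd).2
  have trace_le : (2 * B)⁻¹ * ((A - C) * (A - C)).trace ≤
      ((A - C) * (A + C)⁻¹ * (A - C)).trace := by
    have h := (posSemidef_mul_mul_transpose hinv (A - C)).trace_nonneg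
    rw [hsymm, Matrix.mul_sub (A - C) (A + C)⁻¹, Matrix.sub_mul ((A - C) * (A + C)⁻¹),
      Matrix.trace_sub, sub_nonneg] at h
    simpa using h
  have norm_le : ‖A - C‖ ^ 2 ≤ ((A - C) * (A - C)).trace := by
    have hstar : (A - C)ᴴ = A - C := hsymm
    have h := norm_le_trace (Matrix.posSemidef_conjTranspose_mul_self (A - C))
    rwa [Matrix.l2_opNorm_conjTranspose_mul_self, ← sq, hstar] at h
  rw [sub_mul_inv_add_mul_sub hA.1 hC.1, inv_mul_le_iff₀ (mul_pos two_pos hB)] at trace_le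
  simpa [Matrix.trace_sub] using norm_le.trans trace_le

lemma trace_le_mul_of_mem_paramSpace {A : Matrix (Fin d) (Fin d) ℝ} (hB : 0 ≤ B)
    (hA : A ∈ paramSpace d B) : A.trace ≤ B * d := by
  simpa [Matrix.trace_sub] using ((mem_paramSpace_iff hB).1 hA).2.trace_nonneg

end HarmonicMean

section Midpoint

variable {n d : ℕ} {B : ℝ} {S : Matrix (Fin d) (Fin d) ℝ}

/-- The randomized estimator that chooses between two estimators by tossing a fair coin. -/
def RandomizedEstimator.coin (δ η : Estimator n d B) :
    RandomizedEstimator (Set.univ : Set (Estimator n d B)) where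
  Seed := Bool
  law := (PMF.uniformOfFintype Bool).toMeasure
  draw b := bif b then δ else η
  draw_mem _ := Set.mem_univ _
  measurable_draw i j := measurable_from_prod_countable_right <| by
    rintro (_ | _)
    exacts [η.measurable_est i j, δ.measurable_est i j]

/-- The estimator that takes the harmonic mean of two estimates. -/
def Estimator.midpoint (hB : 0 < B) (δ η : Estimator n d B) : Estimator n d B :=
  (RandomizedEstimator.coin δ η).derandomize hB

lemma Estimator.midpoint_est (hB : 0 < B) (δ η : Estimator n d B) (X : Sample n d) :
    (δ.midpoint hB η).est X = harmonicMean (δ.est X) (η.est X) := by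
  have hint : Integrable (fun b : Bool => ((bif b then δ else η).est X)⁻¹)
      (PMF.uniformOfFintype Bool).toMeasure := .of_finite
  have h := averageEstimate_of_integrable (B := B) hint
  rw [PMF.integral_eq_sum] at h
  refine h.trans ?_
  simp [harmonicMean]

lemma Estimator.risk_midpoint_le (hB : 0 < B) {δ η : Estimator n d B} (hS : S.PosDef) {c : ℝ≥0∞}
    (hδ : δ.risk S ≤ c) (hη : η.risk S ≤ c) : (δ.midpoint hB η).risk S ≤ c :=
  calc (δ.midpoint hB η).risk S
      ≤ ∫⁻ b, (bif b then δ else η).risk S ∂(PMF.uniformOfFintype Bool).toMeasure :=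
        (RandomizedEstimator.coin δ η).risk_derandomize_le hB hS
    _ ≤ ∫⁻ _, c ∂(PMF.uniformOfFintype Bool).toMeasure := by
        refine lintegral_mono ?_
        rintro (_ | _)
        exacts [hη, hδ]
    _ = c := by rw [lintegral_const, measure_univ, mul_one]

end Midpoint

section MeanTrace

variable {n d : ℕ} {B : ℝ}

/-- The expected trace of an estimator under the standard normal law. -/
def Estimator.meanTrace (δ : Estimator n d B) : ℝ :=
  ∫ X, (δ.est X).trace ∂(sampleLaw n (1 : Matrix (Fin d) (Fin d) ℝ))

lemma Estimator.norm_trace_le (hB : 0 < B) (δ : Estimator n d B) (X : Sample n d) :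
    ‖(δ.est X).trace‖ ≤ B * d := by
  rw [Real.norm_of_nonneg (δ.est_mem X).1.posSemidef.trace_nonneg]
  exact trace_le_mul_of_mem_paramSpace hB.le (δ.est_mem X)

lemma Estimator.integrable_trace (hB : 0 < B) (δ : Estimator n d B) :
    Integrable (fun X => (δ.est X).trace) (sampleLaw n (1 : Matrix (Fin d) (Fin d) ℝ)) :=
  .of_bound (continuous_id.matrix_trace.measurable.comp δ.measurable).aestronglyMeasurable (B * d)
    (.of_forall (δ.norm_trace_le hB))

lemma Estimator.abs_meanTrace_le (hB : 0 < B) (δ : Estimator n d B) : |δ.meanTrace| ≤ B * d := by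
  simpa [meanTrace] using norm_integral_le_of_norm_le_const (μ := sampleLaw n 1)
    (.of_forall (δ.norm_trace_le hB))

/-- The expected trace is uniformly convex along harmonic means, with respect to the distance in
mean square. -/
lemma Estimator.eLpNorm_sub_sq_le (hB : 0 < B) (δ η : Estimator n d B) :
    eLpNorm (δ.est - η.est) 2 (sampleLaw n (1 : Matrix (Fin d) (Fin d) ℝ)) ^ 2 ≤
      ENNReal.ofReal
        (2 * B * (δ.meanTrace + η.meanTrace - 2 * (δ.midpoint hB η).meanTrace)) := by
  set ν := sampleLaw n (1 : Matrix (Fin d) (Fin d) ℝ)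
  set gap : Sample n d → ℝ := fun X =>
    2 * B * ((δ.est X).trace + (η.est X).trace - 2 * ((δ.midpoint hB η).est X).trace)
  have norm_sq_le (X : Sample n d) : ‖δ.est X - η.est X‖ ^ 2 ≤ gap X := by
    simpa only [gap, midpoint_est] using norm_sub_sq_le hB (δ.est_mem X) (η.est_mem X)
  have hδη : Integrable (fun X => (δ.est X).trace + (η.est X).trace) ν :=
    (δ.integrable_trace hB).add (η.integrable_trace hB)
  have hmid := ((δ.midpoint hB η).integrable_trace hB).const_mul 2
  have integrable_gap : Integrable gap ν := (hδη.sub hmid).const_mul (2 * B)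
  have integral_gap : ∫ X, gap X ∂ν =
      2 * B * (δ.meanTrace + η.meanTrace - 2 * (δ.midpoint hB η).meanTrace) := by
    rw [integral_const_mul, integral_sub hδη hmid, integral_const_mul,
      integral_add (δ.integrable_trace hB) (η.integrable_trace hB)]
    rfl
  calc eLpNorm (δ.est - η.est) 2 ν ^ 2
      = ∫⁻ X, ‖δ.est X - η.est X‖ₑ ^ 2 ∂ν := by
        simpa using eLpNorm_nnreal_pow_eq_lintegral (f := δ.est - η.est) (μ := ν)
          (two_ne_zero (α := NNReal))
    _ ≤ ∫⁻ X, ENNReal.ofReal (gap X) ∂ν := by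
        refine lintegral_mono fun X => ?_
        rw [← ofReal_norm, ← ENNReal.ofReal_pow (norm_nonneg _)]
        exact ENNReal.ofReal_le_ofReal (norm_sq_le X)
    _ = _ := by
        rw [← ofReal_integral_eq_lintegral_ofReal integrable_gap
          (.of_forall fun X => (sq_nonneg _).trans (norm_sq_le X)), integral_gap]

end MeanTrace

/-! ### Minimizing sequences -/

section MinimizingSequence

open Filter Topology

/-- Near-minimizers of `φ` on a decreasing sequence of sets closed under midpoints have small
convexity gaps, since both they and their midpoints nearly attain the limit of the infima. -/
lemma exists_seq_midpoint_gap_le {α : Type*} {φ : α → ℝ} {mid : α → α → α} {K : ℕ → Set α} {b : ℝ}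
    {ε : ℕ → ℝ} (hφ : ∀ x, |φ x| ≤ b) (hK : Antitone K) (hne : ∀ k, (K k).Nonempty)
    (hmid : ∀ k, ∀ x ∈ K k, ∀ y ∈ K k, mid x y ∈ K k) (hε : Antitone ε) (hε₀ : ∀ N, 0 < ε N) :
    ∃ x : ℕ → α, (∀ k, x k ∈ K k) ∧
      ∀ N k l, N ≤ k → N ≤ l → φ (x k) + φ (x l) - 2 * φ (mid (x k) (x l)) ≤ 4 * ε N := by
  let v : ℕ → ℝ := fun k => sInf (φ '' K k)
  have bddBelow (k) : BddBelow (φ '' K k) :=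
    ⟨-b, Set.forall_mem_image.2 fun x _ => (abs_le.1 (hφ x)).1⟩
  have v_le {k x} (hx : x ∈ K k) : v k ≤ φ x := csInf_le (bddBelow k) (Set.mem_image_of_mem φ hx)
  have v_mono : Monotone v := fun k l hkl =>
    csInf_le_csInf (bddBelow k) ((hne l).image _) (Set.image_mono (hK hkl))
  have v_bdd : BddAbove (Set.range v) := ⟨b, Set.forall_mem_range.2 fun k =>
    (v_le (hne k).some_mem).trans (abs_le.1 (hφ _)).2⟩
  have exists_near (N) : ∃ r, N ≤ r ∧ (⨆ k, v k) - ε N ≤ v r ∧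
      ∃ x ∈ K r, φ x ≤ (⨆ k, v k) + ε N := by
    obtain ⟨r, hr, hNr⟩ := (((tendsto_atTop_ciSup v_mono v_bdd).eventually
      (lt_mem_nhds (sub_lt_self _ (hε₀ N)))).and (eventually_ge_atTop N)).exists
    obtain ⟨_, ⟨x, hx, rfl⟩, hlt⟩ := exists_lt_of_csInf_lt ((hne r).image φ)
      (lt_add_of_pos_right (v r) (hε₀ N))
    exact ⟨r, hNr, hr.le, x, hx, hlt.le.trans (by gcongr; exact le_ciSup v_bdd r)⟩
  choose r le_r near_r x hxK hx using exists_near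
  refine ⟨x, fun k => hK (le_r k) (hxK k), fun N k l hk hl => ?_⟩
  have near_min : (⨆ k, v k) - ε N ≤ v (min (r k) (r l)) := by
    rcases min_choice (r k) (r l) with h | h <;> rw [h]
    · linarith [near_r k, hε hk]
    · linarith [near_r l, hε hl]
  have mid_ge := near_min.trans (v_le (hmid _ _ (hK (min_le_left _ (r l)) (hxK k)) _
    (hK (min_le_right (r k) _) (hxK l))))
  linarith [hx k, hx l, hε hk, hε hl]

variable {n d : ℕ} {B : ℝ}

lemma exists_measurable_tendsto_of_meanTrace_gap_le (hB : 0 < B) {δ : ℕ → Estimator n d B}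
    (hδ : ∀ N k l, N ≤ k → N ≤ l → (δ k).meanTrace + (δ l).meanTrace -
      2 * ((δ k).midpoint hB (δ l)).meanTrace ≤ 4 * ((1 / 4) ^ N / (16 * B))) :
    ∃ f : Sample n d → Matrix (Fin d) (Fin d) ℝ, Measurable f ∧
      ∀ᵐ X ∂(sampleLaw n (1 : Matrix (Fin d) (Fin d) ℝ)),
        Tendsto (fun k => (δ k).est X) atTop (𝓝 (f X)) := by
  refine measurable_limit_of_tendsto_metrizable_ae (fun k => (δ k).measurable.aemeasurable) ?_
  refine Lp.ae_tendsto_of_cauchy_eLpNorm (p := 2)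
    (B := fun N => ENNReal.ofReal ((1 / 2) ^ N))
    (fun k => (δ k).measurable.aestronglyMeasurable) one_le_two ?_ fun N k l hk hl => ?_
  · rw [← ENNReal.ofReal_tsum_of_nonneg (fun N => by positivity) summable_geometric_two]
    exact ENNReal.ofReal_ne_top
  · refine lt_of_pow_lt_pow_left' 2 (((δ k).eLpNorm_sub_sq_le hB (δ l)).trans_lt ?_)
    rw [← ENNReal.ofReal_pow (by positivity), ENNReal.ofReal_lt_ofReal_iff (by positivity)]
    calc 2 * B * ((δ k).meanTrace + (δ l).meanTrace - 2 * ((δ k).midpoint hB (δ l)).meanTrace)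
        ≤ 2 * B * (4 * ((1 / 4) ^ N / (16 * B))) := by gcongr; exact hδ N k l hk hl
      _ = (1 / 4) ^ N / 2 := by field_simp; norm_num
      _ < (1 / 4) ^ N := half_lt_self (by positivity)
      _ = ((1 / 2) ^ N) ^ 2 := by rw [← pow_mul, mul_comm N, pow_mul]; norm_num

end MinimizingSequence

/-! ### Existence of an equivariant minimax estimator -/

section Limit

open Filter Topology

variable {n d : ℕ} {B : ℝ} {A : ℕ → Matrix (Fin d) (Fin d) ℝ} {M S : Matrix (Fin d) (Fin d) ℝ}

lemma measurableSet_paramSpace : MeasurableSet (paramSpace d B) := by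
  have paramSpace_eq : paramSpace d B =
      ({M : Matrix (Fin d) (Fin d) ℝ | M.PosSemidef} ∩ {M | M.det ≠ 0}) ∩ {M | ‖M‖ ≤ B} := by
    ext M
    exact and_congr_left fun _ =>
      ⟨fun h => ⟨h.posSemidef, h.det_pos.ne'⟩, fun h => h.1.posDef_iff_det_ne_zero.2 h.2⟩
  rw [paramSpace_eq]
  exact (isClosed_setOf_posSemidef.measurableSet.inter
    (isOpen_ne_fun continuous_id.matrix_det continuous_const).measurableSet).inter
      (isClosed_le continuous_norm continuous_const).measurableSet

/-- The estimator that agrees with `f` wherever the values of `f` are admissible estimates. -/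
def Estimator.ofMeasurable (hB : 0 < B) {f : Sample n d → Matrix (Fin d) (Fin d) ℝ}
    (hf : Measurable f) : Estimator n d B where
  est X := open Classical in if f X ∈ paramSpace d B then f X else B • 1
  measurable_est := measurable_matrix_iff.1 <|
    Measurable.ite (hf measurableSet_paramSpace) hf measurable_const
  est_mem X := by
    split_ifs with h
    exacts [h, smul_one_mem_paramSpace hB]

lemma mem_paramSpace_of_tendsto (hA : ∀ k, A k ∈ paramSpace d B) (hM : Tendsto A atTop (𝓝 M))
    (hdet : M.det ≠ 0) : M ∈ paramSpace d B :=
  ⟨(isClosed_setOf_posSemidef.mem_of_tendsto hM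
      (.of_forall fun k => (hA k).1.posSemidef)).posDef_iff_det_ne_zero.2 hdet,
    le_of_tendsto hM.norm (.of_forall fun k => (hA k).2)⟩

lemma tendsto_entropyLoss (hA : ∀ k, (A k).PosDef) (hM : M.PosDef) (hS : S.PosDef)
    (h : Tendsto A atTop (𝓝 M)) :
    Tendsto (fun k => entropyLoss (A k) S) atTop (𝓝 (entropyLoss M S)) := by
  have hdet : Tendsto (fun k => (A k).det) atTop (𝓝 M.det) :=
    (continuous_id.matrix_det.tendsto M).comp h
  have hinv : Tendsto (fun k => (A k)⁻¹) atTop (𝓝 M⁻¹) := by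
    simp only [Matrix.inv_def, Ring.inverse_eq_inv']
    exact (hdet.inv₀ hM.det_pos.ne').smul ((continuous_id.matrix_adjugate.tendsto M).comp h)
  have htrace : Tendsto (fun k => ((A k)⁻¹ * S).trace) atTop (𝓝 (M⁻¹ * S).trace) :=
    (continuous_id.matrix_trace.tendsto _).comp (hinv.mul_const S)
  simp only [entropyLoss_eq (hA _) hS, entropyLoss_eq hM hS]
  exact ((htrace.add (hdet.log hM.det_pos.ne')).sub_const _).sub_const _

lemma tendsto_entropyLoss_atTop (hA : ∀ k, (A k).PosDef) (hS : S.PosDef)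
    (h : Tendsto A atTop (𝓝 M)) (hM : M.det = 0) :
    Tendsto (fun k => entropyLoss (A k) S) atTop atTop := by
  have hdet : Tendsto (fun k => (A k).det) atTop (𝓝[>] 0) :=
    tendsto_nhdsWithin_iff.2 ⟨hM ▸ (continuous_id.matrix_det.tendsto M).comp h,
      .of_forall fun k => (hA k).det_pos⟩
  have hlog : Tendsto (fun k => Real.log (A k).det) atTop atBot :=
    Real.tendsto_log_nhdsGT_zero.comp hdet
  refine tendsto_atTop_mono (fun k => log_det_sub_log_det_le_entropyLoss (hA k) hS) ?_
  simp only [sub_eq_add_neg]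
  exact tendsto_atTop_add_const_right _ _ <| tendsto_atTop_add_const_right _ _ <|
    tendsto_atTop_add_const_left _ _ <| tendsto_neg_atBot_atTop.comp hlog

/-- The loss is lower semicontinuous, being infinite at singular limits. -/
lemma Estimator.risk_ofMeasurable_le_liminf (hB : 0 < B) {δ : ℕ → Estimator n d B}
    {f : Sample n d → Matrix (Fin d) (Fin d) ℝ} (hf : Measurable f)
    (hδ : ∀ᵐ X ∂(sampleLaw n (1 : Matrix (Fin d) (Fin d) ℝ)),
      Tendsto (fun k => (δ k).est X) atTop (𝓝 (f X)))
    (hS : S.PosDef) :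
    (Estimator.ofMeasurable hB hf).risk S ≤ liminf (fun k => (δ k).risk S) atTop := by
  refine le_trans (lintegral_mono_ae ?_) (lintegral_liminf_le fun k =>
    ((measurable_entropyLoss S).comp (δ k).measurable).ennreal_ofReal)
  filter_upwards [(sampleLaw_absolutelyContinuous hS).ae_le hδ] with X hX
  have posDef (k) : ((δ k).est X).PosDef := ((δ k).est_mem X).1
  by_cases hdet : (f X).det = 0
  · have htop : Tendsto (fun k => ENNReal.ofReal (entropyLoss ((δ k).est X) S)) atTop (𝓝 ∞) :=
      ENNReal.tendsto_ofReal_atTop.comp (tendsto_entropyLoss_atTop posDef hS hX hdet)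
    exact le_top.trans htop.liminf_eq.ge
  · have hmem := mem_paramSpace_of_tendsto (fun k => (δ k).est_mem X) hX hdet
    have est_eq : (ofMeasurable hB hf).est X = f X := if_pos hmem
    rw [est_eq]
    exact (ENNReal.tendsto_ofReal (tendsto_entropyLoss posDef hmem.1 hS hX)).liminf_eq.ge

end Limit

section Existence

open Filter Topology

variable {n d : ℕ} {B : ℝ}

/-- A deterministic estimator as a degenerate randomized estimator. -/
def RandomizedEstimator.pure {C : Set (Estimator n d B)} (δ : Estimator n d B) (hδ : δ ∈ C) :
    RandomizedEstimator C where
  Seed := Unit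
  law := Measure.dirac ()
  draw _ := δ
  draw_mem _ := hδ
  measurable_draw i j := (δ.measurable_est i j).comp measurable_snd

lemma RandomizedEstimator.risk_pure {C : Set (Estimator n d B)} {δ : Estimator n d B}
    (hδ : δ ∈ C) (S : Matrix (Fin d) (Fin d) ℝ) :
    (RandomizedEstimator.pure δ hδ).risk S = δ.risk S :=
  lintegral_dirac () _

lemma exists_seq_risk_le_ae_tendsto (hB : 0 < B) {c : ℕ → ℝ≥0∞} (hc : Antitone c)
    (hne : ∀ k, ∃ δ : Estimator n d B, ∀ S ∈ paramSpace d B, δ.risk S ≤ c k) :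
    ∃ (δ : ℕ → Estimator n d B) (f : Sample n d → Matrix (Fin d) (Fin d) ℝ),
      (∀ k, ∀ S ∈ paramSpace d B, (δ k).risk S ≤ c k) ∧ Measurable f ∧
        ∀ᵐ X ∂(sampleLaw n (1 : Matrix (Fin d) (Fin d) ℝ)),
          Tendsto (fun k => (δ k).est X) atTop (𝓝 (f X)) := by
  obtain ⟨δ, hδ, hgap⟩ := exists_seq_midpoint_gap_le
    (K := fun k => {δ : Estimator n d B | ∀ S ∈ paramSpace d B, δ.risk S ≤ c k})
    (mid := fun δ η => δ.midpoint hB η) (ε := fun N => (1 / 4) ^ N / (16 * B))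
    (fun δ => δ.abs_meanTrace_le hB) (fun k l hkl δ hδ S hS => (hδ S hS).trans (hc hkl)) hne
    (fun k δ hδ η hη S hS => Estimator.risk_midpoint_le hB hS.1 (hδ S hS) (hη S hS))
    (fun k l hkl => div_le_div_of_nonneg_right
      (pow_le_pow_of_le_one (by norm_num) (by norm_num) hkl) (by positivity))
    (fun N => by positivity)
  obtain ⟨f, hf, htendsto⟩ := exists_measurable_tendsto_of_meanTrace_gap_le hB hgap
  exact ⟨δ, f, hδ, hf, htendsto⟩

lemma exists_isEquivariant_risk_le_minimaxRisk (hB : 0 < B) :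
    ∃ δ : Estimator n d B, δ.IsEquivariant ∧
      ∀ S ∈ paramSpace d B, δ.risk S ≤ minimaxRisk n d B := by
  let worstRisk : RandomizedEstimator (Set.univ : Set (Estimator n d B)) → ℝ≥0∞ :=
    fun T => ⨆ S ∈ paramSpace d B, T.risk S
  have nonempty : (Set.range worstRisk).Nonempty :=
    ⟨_, .pure (.ofMeasurable hB measurable_const (f := 0)) (Set.mem_univ _), rfl⟩
  obtain ⟨c, c_anti, c_tendsto, c_mem⟩ := exists_seq_tendsto_sInf nonempty (OrderBot.bddBelow _)
  have exists_le (k) : ∃ δ : Estimator n d B, ∀ S ∈ paramSpace d B, δ.risk S ≤ c k := by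
    obtain ⟨T, hT⟩ := c_mem k
    exact ⟨T.derandomize hB, fun S hS => (T.risk_derandomize_le hB hS.1).trans
      (hT ▸ le_iSup₂ (f := fun S (_ : S ∈ paramSpace d B) => T.risk S) S hS)⟩
  obtain ⟨δ, f, hδ, hf, htendsto⟩ := exists_seq_risk_le_ae_tendsto hB c_anti exists_le
  refine exists_isEquivariant_risk_le hB
    (.pure (.ofMeasurable hB hf) (Set.mem_univ _)) fun S hS => ?_
  calc _ = (Estimator.ofMeasurable hB hf).risk S := RandomizedEstimator.risk_pure _ S
    _ ≤ liminf (fun k => (δ k).risk S) atTop :=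
        Estimator.risk_ofMeasurable_le_liminf hB hf htendsto hS.1
    _ ≤ liminf c atTop := liminf_le_liminf (.of_forall fun k => hδ k S hS)
    _ = minimaxRisk n d B := c_tendsto.liminf_eq

end Existence

/-! ### Power sums -/

section PowerSums

lemma aeval_esymm_eq_of_sum_pow_eq {σ R : Type*} [Fintype σ] [CommRing R] [IsDomain R] [CharZero R]
    {x y : σ → R} (h : ∀ k, 0 < k → k ≤ Fintype.card σ → ∑ i, x i ^ k = ∑ i, y i ^ k) {k : ℕ}
    (hk : k ≤ Fintype.card σ) :
    MvPolynomial.aeval x (MvPolynomial.esymm σ R k) =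
      MvPolynomial.aeval y (MvPolynomial.esymm σ R k) := by
  classical
  induction k using Nat.strong_induction_on with
  | _ k ih =>
    rcases k.eq_zero_or_pos with rfl | hpos
    · simp
    · have newton (z : σ → R) := congrArg (MvPolynomial.aeval z)
        (MvPolynomial.mul_esymm_eq_sum σ R k)
      simp only [map_mul, map_natCast, map_sum, map_pow, map_neg, map_one] at newton
      refine mul_left_cancel₀ (Nat.cast_ne_zero.2 hpos.ne') ((newton x).trans (.trans ?_
        (newton y).symm))
      congr 1
      refine Finset.sum_congr rfl fun a ha => ?_
      rw [Finset.mem_filter, Finset.HasAntidiagonal.mem_antidiagonal] at ha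
      have psum_eq := h a.2 (by lia) (by lia)
      rw [ih a.1 ha.2 (by lia)]
      simp only [MvPolynomial.psum, map_sum, map_pow, MvPolynomial.aeval_X, psum_eq]

lemma map_univ_eq_of_sum_pow_eq {σ R : Type*} [Fintype σ] [CommRing R] [IsDomain R] [CharZero R]
    {x y : σ → R} (h : ∀ k, 0 < k → k ≤ Fintype.card σ → ∑ i, x i ^ k = ∑ i, y i ^ k) :
    (Finset.univ.val.map x : Multiset R) = Finset.univ.val.map y := by
  have card_eq (z : σ → R) : (Finset.univ.val.map z).card = Fintype.card σ := by simp
  have prod_eq : ((Finset.univ.val.map x).map fun t => Polynomial.X - Polynomial.C t).prod =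
      ((Finset.univ.val.map y).map fun t => Polynomial.X - Polynomial.C t).prod := by
    rw [Multiset.prod_X_sub_X_eq_sum_esymm, Multiset.prod_X_sub_X_eq_sum_esymm, card_eq, card_eq]
    refine Finset.sum_congr rfl fun j hj => ?_
    have esymm_eq := aeval_esymm_eq_of_sum_pow_eq h (Finset.mem_range_succ_iff.1 hj)
    rw [MvPolynomial.aeval_esymm_eq_multiset_esymm,
      MvPolynomial.aeval_esymm_eq_multiset_esymm] at esymm_eq
    rw [esymm_eq]
  simpa only [Polynomial.roots_multiset_prod_X_sub_C] using congrArg Polynomial.roots prod_eq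

variable {d : ℕ}

/-- The first `d` powers of `x`, with exponents starting at `1`. -/
def powers (d : ℕ) (x : ℝ) : Fin d → ℝ := fun k => x ^ ((k : ℕ) + 1)

/-- The first `d` power sums of a tuple of length `d`. -/
def powerSums (D : Fin d → ℝ) : Fin d → ℝ := ∑ i, powers d (D i)

@[fun_prop]
lemma measurable_powers : Measurable (powers d) := by
  unfold powers
  fun_prop

@[fun_prop]
lemma measurable_powerSums : Measurable (powerSums : (Fin d → ℝ) → Fin d → ℝ) := by
  unfold powerSums
  fun_prop

lemma powerSums_comp_perm (D : Fin d → ℝ) (σ : Equiv.Perm (Fin d)) :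
    powerSums (D ∘ σ) = powerSums D :=
  Equiv.sum_comp σ fun i => powers d (D i)

lemma powerSums_injOn_antitone : Set.InjOn powerSums {D : Fin d → ℝ | Antitone D} := by
  intro x hx y hy h
  have map_eq : (Finset.univ.val.map x : Multiset ℝ) = Finset.univ.val.map y := by
    refine map_univ_eq_of_sum_pow_eq fun k hk hkd => ?_
    rw [Fintype.card_fin] at hkd
    have hsum := congrFun h ⟨k - 1, by lia⟩
    simpa only [powerSums, powers, Finset.sum_apply, Nat.sub_add_cancel hk] using hsum
  rw [Fin.univ_val_map, Fin.univ_val_map, Multiset.coe_eq_coe] at map_eq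
  exact List.ofFn_injective <| map_eq.eq_of_pairwise'
    (List.sortedGE_ofFn_iff.2 hx).pairwise (List.sortedGE_ofFn_iff.2 hy).pairwise

/-- The Lusin–Souslin theorem makes the inverse of an injective Borel map Borel. -/
lemma exists_measurable_leftInverse_powerSums (d : ℕ) :
    ∃ H : (Fin d → ℝ) → Fin d → ℝ, Measurable H ∧ ∀ D, Antitone D → H (powerSums D) = D := by
  have isClosed : IsClosed {D : Fin d → ℝ | Antitone D} := by
    simp only [Antitone, Set.ofPred_forall]
    exact isClosed_iInter fun i => isClosed_iInter fun j => isClosed_iInter fun _ =>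
      isClosed_le (continuous_apply j) (continuous_apply i)
  have := isClosed.measurableSet.standardBorel
  have embedding : MeasurableEmbedding fun D : {D : Fin d → ℝ | Antitone D} => powerSums D.1 :=
    (measurable_powerSums.comp measurable_subtype_coe).measurableEmbedding
      powerSums_injOn_antitone.injective
  obtain ⟨H, hH, hHD⟩ := embedding.exists_measurable_extend measurable_subtype_coe fun _ => ⟨0⟩
  exact ⟨H, hH, fun D hD => congrFun hHD ⟨D, hD⟩⟩

end PowerSums

/-! ### Eigendecompositions -/

section Eigendecomposition

lemma update_one_neg_one_mul_self {m : Type*} [DecidableEq m] (i k : m) :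
    (Function.update 1 i (-1) : m → ℝ) k * (Function.update 1 i (-1) : m → ℝ) k = 1 := by
  by_cases h : k = i <;> simp [h]

variable {m : Type*} [Fintype m] [DecidableEq m] {U M : Matrix m m ℝ}

lemma submatrix_mem_orthogonalGroup (hU : U ∈ Matrix.orthogonalGroup m ℝ) (σ : Equiv.Perm m) :
    U.submatrix id σ ∈ Matrix.orthogonalGroup m ℝ := by
  rw [Matrix.mem_orthogonalGroup_iff, Matrix.transpose_submatrix, Matrix.submatrix_mul_equiv,
    mul_transpose_of_mem_orthogonalGroup hU, Matrix.submatrix_id_id]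

lemma submatrix_mul_diagonal_mul (U : Matrix m m ℝ) (σ : Equiv.Perm m) (E : m → ℝ) :
    U.submatrix id σ * Matrix.diagonal (E ∘ σ) * (U.submatrix id σ)ᵀ =
      U * Matrix.diagonal E * Uᵀ := by
  rw [Matrix.transpose_submatrix, ← Matrix.submatrix_diagonal_equiv, Matrix.submatrix_mul_equiv,
    Matrix.submatrix_mul_equiv, Matrix.submatrix_id_id]

lemma rank_mul_diagonal_mul_transpose (hU : U ∈ Matrix.orthogonalGroup m ℝ) (D : m → ℝ) :
    (U * Matrix.diagonal D * Uᵀ).rank = Fintype.card {i // D i ≠ 0} := by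
  have hdet := (Matrix.isUnit_iff_isUnit_det U).1 (isUnit_of_mem_orthogonalGroup hU)
  rw [Matrix.rank_mul_eq_left_of_isUnit_det _ _ (by rwa [Matrix.det_transpose]),
    Matrix.rank_mul_eq_right_of_isUnit_det _ _ hdet, Matrix.rank_diagonal]

lemma nonneg_of_posSemidef_mul_diagonal_mul (hU : U ∈ Matrix.orthogonalGroup m ℝ) {D : m → ℝ}
    (h : (U * Matrix.diagonal D * Uᵀ).PosSemidef) (i : m) : 0 ≤ D i := by
  have hdiag := posSemidef_mul_mul_transpose h Uᵀ
  rw [Matrix.transpose_transpose, transpose_mul_mul_transpose_mul hU] at hdiag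
  exact Matrix.posSemidef_diagonal_iff.1 hdiag i

/-- The reflection that changes the sign of the `i`-th coordinate. -/
def signFlip (i : m) : Matrix m m ℝ := Matrix.diagonal (Function.update 1 i (-1))

lemma signFlip_mem_orthogonalGroup (i : m) : signFlip i ∈ Matrix.orthogonalGroup m ℝ := by
  rw [Matrix.mem_orthogonalGroup_iff, signFlip, Matrix.diagonal_transpose,
    Matrix.diagonal_mul_diagonal]
  simp only [update_one_neg_one_mul_self, Matrix.diagonal_one]

lemma signFlip_mul_diagonal_mul_transpose (i : m) (D : m → ℝ) :
    signFlip i * Matrix.diagonal D * (signFlip i)ᵀ = Matrix.diagonal D := by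
  rw [signFlip, Matrix.diagonal_transpose, Matrix.diagonal_mul_diagonal,
    Matrix.diagonal_mul_diagonal]
  simp only [mul_right_comm _ (D _), update_one_neg_one_mul_self, one_mul]

lemma isDiag_of_signFlip_mul_mul_transpose
    (h : ∀ i, signFlip i * M * (signFlip i)ᵀ = M) : M.IsDiag := by
  intro i j hij
  have hentry := congrFun (congrFun (h i) i) j
  rw [signFlip, Matrix.diagonal_transpose, Matrix.mul_diagonal, Matrix.diagonal_mul,
    Function.update_self, Function.update_of_ne hij.symm, Pi.one_apply] at hentry
  linarith

variable {d : ℕ}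

lemma exists_perm_antitone (D : Fin d → ℝ) : ∃ σ : Equiv.Perm (Fin d), Antitone (D ∘ σ) :=
  ⟨Tuple.sort (OrderDual.toDual ∘ D), Tuple.monotone_sort (OrderDual.toDual ∘ D)⟩

lemma exists_antitone_eigendecomposition {A : Matrix (Fin d) (Fin d) ℝ} (hA : A.IsHermitian) :
    ∃ U ∈ Matrix.orthogonalGroup (Fin d) ℝ, ∃ D : Fin d → ℝ, Antitone D ∧
      A = U * Matrix.diagonal D * Uᵀ := by
  obtain ⟨σ, hσ⟩ := exists_perm_antitone hA.eigenvalues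
  refine ⟨_, submatrix_mem_orthogonalGroup hA.eigenvectorUnitary.2 σ, _, hσ, ?_⟩
  rw [submatrix_mul_diagonal_mul, ← Matrix.conjTranspose_eq_transpose_of_trivial]
  exact hA.spectral_theorem.trans (Unitary.conjStarAlgAut_apply _ _)

lemma eq_zero_of_antitone_of_rank_le {U : Matrix (Fin d) (Fin d) ℝ}
    (hU : U ∈ Matrix.orthogonalGroup (Fin d) ℝ) {D : Fin d → ℝ} (hD : Antitone D)
    (hD₀ : ∀ i, 0 ≤ D i) {r : ℕ} (hr : (U * Matrix.diagonal D * Uᵀ).rank ≤ r) {i : Fin d}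
    (hi : r ≤ i) : D i = 0 := by
  by_contra hne
  have ne_zero {j} (hj : j ≤ i) : D j ≠ 0 := (((hD₀ i).lt_of_ne' hne).trans_le (hD hj)).ne'
  have card_le : (Finset.Iic i).card ≤ Fintype.card {j // D j ≠ 0} := by
    rw [Fintype.card_subtype]
    exact Finset.card_le_card fun j hj => Finset.mem_filter.2
      ⟨Finset.mem_univ j, ne_zero (Finset.mem_Iic.1 hj)⟩
  rw [rank_mul_diagonal_mul_transpose hU] at hr
  rw [Fin.card_Iic] at card_le
  lia

end Eigendecomposition

/-! ### Equivariant estimators are spectral -/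

section Spectral

variable {n d : ℕ} {B : ℝ}

lemma Estimator.IsEquivariant.est_congr {δ : Estimator n d B} (hδ : δ.IsEquivariant)
    {X Y : Sample n d} (h : empiricalCov X = empiricalCov Y) : δ.est X = δ.est Y := by
  obtain ⟨o, ho, rfl⟩ := exists_mixSample_eq h
  exact (hδ.2 o ho X).symm

lemma rank_empiricalCov_le (X : Sample n d) : (empiricalCov X).rank ≤ n := by
  rw [empiricalCov_eq, ← Matrix.smul_mul]
  exact (Matrix.rank_mul_le_left _ _).trans (Matrix.rank_le_width _)

/-- A sample with empirical covariance matrix `Diag(D)`, provided that `D` is nonnegative and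
vanishes from index `n` on. -/
def canonicalSample (n : ℕ) (D : Fin d → ℝ) : Sample n d :=
  fun k => WithLp.toLp 2 fun i => if (i : ℕ) = k then √(n * D i) else 0

lemma measurable_canonicalSample : Measurable (canonicalSample n : (Fin d → ℝ) → Sample n d) := by
  refine measurable_pi_lambda _ fun k => (PiLp.continuous_toLp 2 _).measurable.comp ?_
  refine measurable_pi_lambda _ fun i => ?_
  split_ifs <;> fun_prop

lemma empiricalCov_canonicalSample {D : Fin d → ℝ} (hD : ∀ i, 0 ≤ D i)
    (hrank : ∀ i : Fin d, n ≤ i → D i = 0) :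
    empiricalCov (canonicalSample n D) = Matrix.diagonal D := by
  ext i j
  have entry : empiricalCov (canonicalSample n D) i j = (n : ℝ)⁻¹ * ∑ k : Fin n,
      (if (i : ℕ) = k then √(n * D i) else 0) * (if (j : ℕ) = k then √(n * D j) else 0) := by
    simp [empiricalCov_eq, dataMatrix, canonicalSample, Matrix.mul_apply]
  rw [entry]
  rcases lt_or_ge (i : ℕ) n with hi | hi
  · have hn : (n : ℝ) ≠ 0 := Nat.cast_ne_zero.2 (by lia)
    rw [Finset.sum_eq_single ⟨i, hi⟩ (fun k _ hk => by
      rw [if_neg fun h => hk (Fin.ext h.symm), zero_mul]) (by simp), if_pos rfl]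
    by_cases hij : i = j
    · subst hij
      rw [if_pos rfl, Real.mul_self_sqrt (mul_nonneg n.cast_nonneg (hD i)),
        inv_mul_cancel_left₀ hn, Matrix.diagonal_apply_eq]
    · rw [if_neg fun h => hij (Fin.ext h.symm), Matrix.diagonal_apply_ne _ hij, mul_zero, mul_zero]
  · simp [hrank i hi, Matrix.diagonal_apply]

/-- The diagonal of the estimate for `canonicalSample n D`. -/
def Estimator.diagonalEntries (δ : Estimator n d B) (D : Fin d → ℝ) : Fin d → ℝ :=
  (δ.est (canonicalSample n D)).diag

lemma Estimator.measurable_diagonalEntries (δ : Estimator n d B) :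
    Measurable δ.diagonalEntries :=
  measurable_pi_lambda _ fun i => (δ.measurable_est i i).comp measurable_canonicalSample

lemma empiricalCov_canonicalSample_of_eq {X : Sample n d} {U : Matrix (Fin d) (Fin d) ℝ}
    (hU : U ∈ Matrix.orthogonalGroup (Fin d) ℝ) {D : Fin d → ℝ} (hD : Antitone D)
    (h : empiricalCov X = U * Matrix.diagonal D * Uᵀ) :
    empiricalCov (canonicalSample n D) = Matrix.diagonal D := by
  have nonneg := nonneg_of_posSemidef_mul_diagonal_mul hU (h ▸ posSemidef_empiricalCov X)
  exact empiricalCov_canonicalSample nonneg fun i hi =>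
    eq_zero_of_antitone_of_rank_le hU hD nonneg (h ▸ rank_empiricalCov_le X) hi

/-- Reflections in the coordinate hyperplanes preserve a diagonal empirical covariance matrix, so
that they commute with the estimate. -/
lemma Estimator.IsEquivariant.est_canonicalSample {δ : Estimator n d B} (hδ : δ.IsEquivariant)
    {D : Fin d → ℝ} (hD : empiricalCov (canonicalSample n D) = Matrix.diagonal D) :
    δ.est (canonicalSample n D) = Matrix.diagonal (δ.diagonalEntries D) := by
  refine (Matrix.IsDiag.diagonal_diag (isDiag_of_signFlip_mul_mul_transpose fun i => ?_)).symm
  rw [← hδ.1 _ (signFlip_mem_orthogonalGroup i)]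
  refine hδ.est_congr ?_
  rw [empiricalCov_actSample, hD, signFlip_mul_diagonal_mul_transpose]

lemma Estimator.IsEquivariant.est_of_empiricalCov_eq {δ : Estimator n d B} (hδ : δ.IsEquivariant)
    {D : Fin d → ℝ} (hD : empiricalCov (canonicalSample n D) = Matrix.diagonal D)
    {X : Sample n d} {U : Matrix (Fin d) (Fin d) ℝ} (hU : U ∈ Matrix.orthogonalGroup (Fin d) ℝ)
    (h : empiricalCov X = U * Matrix.diagonal D * Uᵀ) :
    δ.est X = U * Matrix.diagonal (δ.diagonalEntries D) * Uᵀ := by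
  rw [← hδ.est_canonicalSample hD, ← hδ.1 U hU]
  refine hδ.est_congr ?_
  rw [empiricalCov_actSample, hD, h]

/-- Transposing two coordinates with the same eigenvalue preserves a diagonal empirical covariance
matrix. -/
lemma Estimator.IsEquivariant.diagonalEntries_eq {δ : Estimator n d B} (hδ : δ.IsEquivariant)
    {D : Fin d → ℝ} (hD : empiricalCov (canonicalSample n D) = Matrix.diagonal D) {i j : Fin d}
    (hij : D i = D j) : δ.diagonalEntries D i = δ.diagonalEntries D j := by
  set P := (1 : Matrix (Fin d) (Fin d) ℝ).submatrix id (Equiv.swap i j)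
  have mul_diagonal_mul (E : Fin d → ℝ) :
      P * Matrix.diagonal (E ∘ Equiv.swap i j) * Pᵀ = Matrix.diagonal E := by
    rw [submatrix_mul_diagonal_mul, Matrix.one_mul, Matrix.transpose_one, Matrix.mul_one]
  have hswap : D ∘ Equiv.swap i j = D := by
    rw [Equiv.comp_swap_eq_update, hij, Function.update_eq_self, ← hij, Function.update_eq_self]
  have conjugation_eq := hδ.est_of_empiricalCov_eq hD
    (submatrix_mem_orthogonalGroup (one_mem _) (Equiv.swap i j))
    (hD.trans ((congrArg (P * Matrix.diagonal · * Pᵀ) hswap) ▸ mul_diagonal_mul D).symm)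
  have hinv : δ.diagonalEntries D =
      (δ.diagonalEntries D ∘ Equiv.swap i j) ∘ Equiv.swap i j := by
    rw [Function.comp_assoc, ← Equiv.coe_trans, Equiv.swap_swap, Equiv.coe_refl,
      Function.comp_id]
  rw [hδ.est_canonicalSample hD, hinv, mul_diagonal_mul, ← hinv] at conjugation_eq
  simpa using congrFun (Matrix.diagonal_injective conjugation_eq) i

/-- The average of those `φ i` for which `D i = x`. -/
def lookup (D φ : Fin d → ℝ) (x : ℝ) : ℝ :=
  (∑ i with D i = x, φ i) / (Finset.univ.filter (D · = x)).card

lemma lookup_apply {D φ : Fin d → ℝ} (h : ∀ i j, D i = D j → φ i = φ j) (i : Fin d) :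
    lookup D φ (D i) = φ i := by
  have hmem : i ∈ Finset.univ.filter (D · = D i) := by simp
  rw [lookup, Finset.sum_congr rfl fun j hj => h j i (Finset.mem_filter.1 hj).2, Finset.sum_const,
    nsmul_eq_mul, mul_div_cancel_left₀ _ (Nat.cast_ne_zero.2 (Finset.card_ne_zero_of_mem hmem))]

lemma measurable_lookup :
    Measurable fun q : (Fin d → ℝ) × (Fin d → ℝ) × ℝ => lookup q.1 q.2.1 q.2.2 := by
  have measurableSet (i) : MeasurableSet {q : (Fin d → ℝ) × (Fin d → ℝ) × ℝ | q.1 i = q.2.2} :=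
    measurableSet_eq_fun (by fun_prop) (by fun_prop)
  simp only [lookup, Finset.sum_filter, Finset.card_filter, Nat.cast_sum, Nat.cast_ite]
  exact (Finset.measurable_sum _ fun i _ => .ite (measurableSet i) (by fun_prop)
    measurable_const).div (Finset.measurable_sum _ fun i _ => .ite (measurableSet i)
      measurable_const measurable_const)

lemma Estimator.IsEquivariant.est_eq_lookup {δ : Estimator n d B} (hδ : δ.IsEquivariant)
    {X : Sample n d} {U : Matrix (Fin d) (Fin d) ℝ} (hU : U ∈ Matrix.orthogonalGroup (Fin d) ℝ)
    {D : Fin d → ℝ} (h : empiricalCov X = U * Matrix.diagonal D * Uᵀ) {σ : Equiv.Perm (Fin d)}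
    (hσ : Antitone (D ∘ σ)) :
    δ.est X =
      U * Matrix.diagonal (fun i => lookup (D ∘ σ) (δ.diagonalEntries (D ∘ σ)) (D i)) * Uᵀ := by
  have hUσ := submatrix_mem_orthogonalGroup hU σ
  have hsorted := h.trans (submatrix_mul_diagonal_mul U σ D).symm
  have hcan := empiricalCov_canonicalSample_of_eq hUσ hσ hsorted
  have entries_eq : δ.diagonalEntries (D ∘ σ) =
      (fun i => lookup (D ∘ σ) (δ.diagonalEntries (D ∘ σ)) (D i)) ∘ σ :=
    funext fun i => (lookup_apply (D := D ∘ σ) (φ := δ.diagonalEntries (D ∘ σ))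
      (fun _ _ => hδ.diagonalEntries_eq hcan) i).symm
  rw [hδ.est_of_empiricalCov_eq hcan hUσ hsorted, ← submatrix_mul_diagonal_mul U σ, ← entries_eq]

/-- The power sums of the eigenvalues are known to the `i`-th entry, and they determine the sorted
eigenvalues in a Borel way. -/
lemma Estimator.IsEquivariant.mem_spectralEstimators {δ : Estimator n d B}
    (hδ : δ.IsEquivariant) : δ ∈ spectralEstimators n d B := by
  obtain ⟨H, hH, H_powerSums⟩ := exists_measurable_leftInverse_powerSums d
  have measurable_sorted :
      Measurable fun p : ℝ × (Fin d → ℝ) => H (powers d p.1 + p.2) := by fun_prop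
  refine ⟨fun x p => lookup (H (powers d x + p)) (δ.diagonalEntries (H (powers d x + p))) x,
    fun _ y => powers d y,
    measurable_lookup.comp (measurable_sorted.prodMk
      ((δ.measurable_diagonalEntries.comp measurable_sorted).prodMk measurable_fst)),
    measurable_powers.comp measurable_snd, fun X U hU D h => ?_⟩
  obtain ⟨σ, hσ⟩ := exists_perm_antitone D
  have sorted_eq (i) : H (powers d (D i) + ∑ j ∈ Finset.univ.erase i, powers d (D j)) = D ∘ σ := by
    rw [Finset.add_sum_erase _ (fun j => powers d (D j)) (Finset.mem_univ i), ← H_powerSums _ hσ,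
      powerSums_comp_perm, powerSums]
  rw [hδ.est_eq_lookup hU h hσ]
  congr 3
  funext i
  rw [spectralEntry, sorted_eq]

end Spectral

/-! ### The reduced game -/

section ReducedGame

variable {n d : ℕ} {B : ℝ} {C C' : Set (Estimator n d B)} {δ : Estimator n d B}

lemma spectralEstimators_subset_invariantEstimators :
    spectralEstimators n d B ⊆ invariantEstimators n d B := by
  rintro δ ⟨f, g, _, _, hδ⟩ V hV X
  obtain ⟨U, hU, D, _, hX⟩ :=
    exists_antitone_eigendecomposition (posSemidef_empiricalCov X).isHermitian
  have hVX : empiricalCov (actSample V X) = V * U * Matrix.diagonal D * (V * U)ᵀ := by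
    rw [empiricalCov_actSample, hX, Matrix.transpose_mul]
    simp only [Matrix.mul_assoc]
  rw [hδ X U hU D hX, hδ _ (V * U) (mul_mem hV hU) D hVX, Matrix.transpose_mul]
  simp only [Matrix.mul_assoc]

lemma Estimator.risk_mul_mul_transpose (hδ : δ ∈ invariantEstimators n d B)
    {g : Matrix (Fin d) (Fin d) ℝ} (hg : g ∈ Matrix.orthogonalGroup (Fin d) ℝ)
    {S : Matrix (Fin d) (Fin d) ℝ} (hS : S.PosSemidef) : δ.risk (g * S * gᵀ) = δ.risk S := by
  have hmeas : Measurable fun Y : Sample n d =>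
      ENNReal.ofReal (entropyLoss (δ.est Y) (g * S * gᵀ)) :=
    ((measurable_entropyLoss _).comp δ.measurable).ennreal_ofReal
  rw [Estimator.risk, ← map_actSample_sampleLaw hS g, lintegral_map hmeas (measurable_actSample g)]
  refine lintegral_congr fun X => ?_
  rw [hδ g hg X, entropyLoss_mul_mul_transpose hg]

lemma diagonal_mem_paramSpace_iff (hB : 0 ≤ B) {l : Fin d → ℝ} :
    Matrix.diagonal l ∈ paramSpace d B ↔ ∀ i, 0 < l i ∧ l i ≤ B := by
  rw [mem_paramSpace_iff hB, ← Matrix.diagonal_one, ← Matrix.diagonal_smul, Matrix.diagonal_sub,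
    Matrix.posDef_diagonal_iff, Matrix.posSemidef_diagonal_iff, forall_and]
  simp

lemma exists_eq_mul_diagonal_mul_of_mem_paramSpace (hB : 0 ≤ B) {S : Matrix (Fin d) (Fin d) ℝ}
    (hS : S ∈ paramSpace d B) :
    ∃ U ∈ Matrix.orthogonalGroup (Fin d) ℝ, ∃ l ∈ spectrumSpace d B,
      S = U * Matrix.diagonal l * Uᵀ := by
  obtain ⟨U, hU, l, hl, rfl⟩ := exists_antitone_eigendecomposition hS.1.isHermitian
  have hdiag := mul_mul_transpose_mem_paramSpace hS (transpose_mem_orthogonalGroup hU)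
  rw [Matrix.transpose_transpose, transpose_mul_mul_transpose_mul hU,
    diagonal_mem_paramSpace_iff hB] at hdiag
  exact ⟨U, hU, l, ⟨hl, hdiag⟩, rfl⟩

/-- A randomized estimator supported on `C`, regarded as supported on a larger class. -/
def RandomizedEstimator.ofSubset (h : C ⊆ C') (T : RandomizedEstimator C) :
    RandomizedEstimator C' where
  Seed := T.Seed
  law := T.law
  draw := T.draw
  draw_mem ω := h (T.draw_mem ω)
  measurable_draw := T.measurable_draw

lemma reducedValue_antitone (h : C ⊆ C') : reducedValue C' ≤ reducedValue C :=
  le_iInf fun T => iInf_le_of_le (T.ofSubset h) le_rfl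

lemma minimaxRisk_le_reducedValue (hB : 0 ≤ B) (hC : C ⊆ invariantEstimators n d B) :
    minimaxRisk n d B ≤ reducedValue C := by
  refine le_iInf fun T => iInf_le_of_le (T.ofSubset (Set.subset_univ _)) (iSup₂_le fun S hS => ?_)
  obtain ⟨U, hU, l, hl, rfl⟩ := exists_eq_mul_diagonal_mul_of_mem_paramSpace hB hS
  have hdiag : (Matrix.diagonal l).PosSemidef :=
    ((diagonal_mem_paramSpace_iff hB).2 hl.2).1.posSemidef
  calc (T.ofSubset (Set.subset_univ _)).risk (U * Matrix.diagonal l * Uᵀ)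
      = T.risk (Matrix.diagonal l) := lintegral_congr fun ω =>
        Estimator.risk_mul_mul_transpose (hC (T.draw_mem ω)) hU hdiag
    _ ≤ ⨆ l ∈ spectrumSpace d B, T.risk (Matrix.diagonal l) :=
        le_iSup₂ (f := fun l (_ : l ∈ spectrumSpace d B) => T.risk (Matrix.diagonal l)) l hl

lemma minimaxRisk_le_iSup_risk (δ : Estimator n d B) :
    minimaxRisk n d B ≤ ⨆ S ∈ paramSpace d B, δ.risk S := by
  refine iInf_le_of_le (.pure δ (Set.mem_univ δ)) ?_
  simp only [RandomizedEstimator.risk_pure, le_refl]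

lemma reducedValue_le_iSup_risk (hB : 0 ≤ B) (hδ : δ ∈ C) :
    reducedValue C ≤ ⨆ S ∈ paramSpace d B, δ.risk S := by
  refine iInf_le_of_le (.pure δ hδ) (iSup₂_le fun l hl => ?_)
  rw [RandomizedEstimator.risk_pure]
  exact le_iSup₂ (f := fun S (_ : S ∈ paramSpace d B) => δ.risk S) _
    ((diagonal_mem_paramSpace_iff hB).2 hl.2)

theorem exists_mem_spectralEstimators_isMinimax (hB : 0 < B) :
    ∃ δ ∈ spectralEstimators n d B, δ.IsMinimax := by
  obtain ⟨δ, hδ, hle⟩ := exists_isEquivariant_risk_le_minimaxRisk (n := n) (d := d) hB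
  exact ⟨δ, hδ.mem_spectralEstimators,
    le_antisymm (iSup₂_le hle) (minimaxRisk_le_iSup_risk δ)⟩

theorem reducedValue_eq_minimaxRisk (hB : 0 < B) (hspectral : spectralEstimators n d B ⊆ C)
    (hinvariant : C ⊆ invariantEstimators n d B) : reducedValue C = minimaxRisk n d B := by
  obtain ⟨δ, hδ, hmin⟩ := exists_mem_spectralEstimators_isMinimax (n := n) (d := d) hB
  exact le_antisymm
    ((reducedValue_antitone hspectral).trans <| (reducedValue_le_iSup_risk hB.le hδ).trans hmin.le)
    (minimaxRisk_le_reducedValue hB.le hinvariant)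

end ReducedGame

end CovarianceGame

end

theorem proposition4 (n d : ℕ) (hn : 0 < n) (hd : 0 < d) (B : ℝ) (hB : 0 < B) :
    (∃ δ : CovarianceGame.Estimator n d B, δ.IsMinimax ∧
      ∀ ε : ℝ, 0 < ε →
        ∃ η ∈ CovarianceGame.spectralEstimators n d B,
          (∀ X, CovarianceGame.opNorm (η.est X - δ.est X) ≤ ε) ∧
          ∀ S ∈ CovarianceGame.paramSpace d B,
            η.risk S ≤ δ.risk S + ENNReal.ofReal ε ∧ δ.risk S ≤ η.risk S + ENNReal.ofReal ε) ∧
    CovarianceGame.reducedValue (CovarianceGame.invariantEstimators n d B) =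
      CovarianceGame.reducedValue (CovarianceGame.spectralEstimators n d B) ∧
    CovarianceGame.reducedValue (CovarianceGame.spectralEstimators n d B) =
      CovarianceGame.minimaxRisk n d B := by
  obtain ⟨δ, hδ, hmin⟩ :=
    CovarianceGame.exists_mem_spectralEstimators_isMinimax (n := n) (d := d) hB
  have hsub : CovarianceGame.spectralEstimators n d B ⊆ CovarianceGame.invariantEstimators n d B :=
    CovarianceGame.spectralEstimators_subset_invariantEstimators
  have invariant_eq := CovarianceGame.reducedValue_eq_minimaxRisk hB hsub subset_rfl
  have spectral_eq := CovarianceGame.reducedValue_eq_minimaxRisk hB subset_rfl hsub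
  refine ⟨⟨δ, hmin, fun ε hε => ⟨δ, hδ, fun X => ?_, fun S _ => ⟨le_self_add, le_self_add⟩⟩⟩,
    invariant_eq.trans spectral_eq.symm, spectral_eq⟩
  rw [sub_self, CovarianceGame.opNorm, map_zero, norm_zero]
  exact hε.le
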